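/- Let $k\ge 1$ and $n\le -1$ be integers, and let $\mathcal K=J(k,2n)$ be the double twist knot, with knot group $$G(\mathcal K)=\langle a,b \mid w^n a=b w^n\rangle,\qquad w=\begin{cases}(ba^{-1})^m(b^{-1}a)^m & \text{if } k=2m,\\ (ba^{-1})^m\,ba\,(b^{-1}a)^m & \text{if } k=2m+1,\end{cases}$$ whose abelianization sends $a$ and $b$ to $t$. Let $\rho_0: G(\mathcal K)\to \mathrm{SL}_2(\mathbb C)$ be a holonomy representation, i.e. a representation with discrete image which induces a faithful representation into $\mathrm{PSL}_2(\mathbb C)$; if $k=1$ (when $\mathcal K$ is not hyperbolic), $\rho_0$ may instead be any non-abelian representation with $\operatorname{tr}\rho_0(a)=\pm 2$. Put $y=\operatorname{tr}\rho_0(ab^{-1})$ and $z=\operatorname{tr}\rho_0(w)$, and let $S_l$ ($l\in\mathbb Z$) be the Chebyshev polynomials defined by $S_0(v)=1$, $S_1(v)=v$, $S_l(v)=vS_{l-1}(v)-S_{l-2}(v)$. Let $\mathrm{Ad}$ be the adjoint action of $\mathrm{SL}_2(\mathbb C)$ on $\mathfrak{sl}_2(\mathbb C)$, let $\Phi:\mathbb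 Z[F(a,b)]\to M_3(\mathbb C[t^{\pm1}])$ be the ring homomorphism with $\Phi(a)=t\,\mathrm{Ad}(\rho_0(a))$ and $\Phi(b)=t\,\mathrm{Ad}(\rho_0(b))$, and let $$\Delta^{\mathrm{Ad}\circ\rho_0}_{\mathcal K}(t)=\frac{\det\Phi(\partial r/\partial a)}{\det\Phi(1-b)},\qquad r=w^naw^{-n}b^{-1},$$ where $\partial/\partial a$ is the Fox derivative. Then $\Delta^{\mathrm{Ad}\circ\rho_0}_{\mathcal K}(t)$ is a Laurent polynomial in $t$, and its highest and lowest degree terms are given by $$\Delta^{\mathrm{Ad}\circ\rho_0}_{\mathcal K}(t)=\begin{cases} c\,t^{0}+\dots-c\,t^{-3},\quad c=m|n|\,S_{m-1}(y)^2S_{|n|-1}(z)^2, & \text{if } k=2m,\\ -c\,t^{-3}+\dots+c\,t^{6n},\quad c=(m+1)\,S_m(y)^2, & \text{if } k=2m+1,\end{cases}$$ where $c\neq 0$ in both cases (and $c=1$ if $k=1$). -/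

import Mathlib

open scoped LaurentPolynomial MatrixGroups

noncomputable section

namespace DoubleTwist

/-! ### Fox calculus -/

section Fox

variable {α : Type} [DecidableEq α]

/-- Left multiplication by elements of `F = FreeGroup α` on the additive group of the group ring
`ℤ[F]`, written multiplicatively so that a semidirect product can be formed. -/
def leftAction :
    FreeGroup α →* MulAut (Multiplicative (MonoidAlgebra ℤ (FreeGroup α))) where
  toFun g := AddEquiv.toMultiplicative
    { toFun := fun x => MonoidAlgebra.of ℤ _ g * x
      invFun := fun x => MonoidAlgebra.of ℤ _ g⁻¹ * x
      left_inv := fun x => by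
        beta_reduce
        rw [← mul_assoc, ← map_mul, inv_mul_cancel, map_one, one_mul]
      right_inv := fun x => by
        beta_reduce
        rw [← mul_assoc, ← map_mul, mul_inv_cancel, map_one, one_mul]
      map_add' := fun x y => mul_add _ x y }
  map_one' := by
    ext x : 1
    change Multiplicative.ofAdd (MonoidAlgebra.of ℤ _ 1 * Multiplicative.toAdd x) = x
    rw [map_one, one_mul]; rfl
  map_mul' g h := by
    ext x : 1
    change Multiplicative.ofAdd (MonoidAlgebra.of ℤ _ (g * h) * Multiplicative.toAdd x) =
      Multiplicative.ofAdd
        (MonoidAlgebra.of ℤ _ g * (MonoidAlgebra.of ℤ _ h * Multiplicative.toAdd x))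
    rw [map_mul (MonoidAlgebra.of ℤ (FreeGroup α)), mul_assoc]

/-- The homomorphism `g ↦ (∂g/∂x, g)` into the semidirect product `ℤ[F] ⋊ F`. -/
def foxHom (x : α) : FreeGroup α →*
    Multiplicative (MonoidAlgebra ℤ (FreeGroup α)) ⋊[leftAction] FreeGroup α :=
  FreeGroup.lift fun y =>
    ⟨Multiplicative.ofAdd (if y = x then 1 else 0), FreeGroup.of y⟩

/-- The Fox derivative `∂g/∂x ∈ ℤ[F]` of a word `g`: the unique map with
`∂y/∂x = δ_{xy}` on generators and `∂(gh)/∂x = ∂g/∂x + g ∂h/∂x`. -/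
def foxDeriv (x : α) (g : FreeGroup α) : MonoidAlgebra ℤ (FreeGroup α) :=
  Multiplicative.toAdd (foxHom x g).left

theorem foxHom_right (x : α) (g : FreeGroup α) : (foxHom x g).right = g := by
  have h : SemidirectProduct.rightHom.comp (foxHom x) = MonoidHom.id (FreeGroup α) := by
    ext y
    simp [foxHom]
  exact DFunLike.congr_fun h g

theorem foxDeriv_of (x y : α) : foxDeriv x (FreeGroup.of y) = if y = x then 1 else 0 := by
  simp [foxDeriv, foxHom]

theorem foxDeriv_mul (x : α) (g h : FreeGroup α) :
    foxDeriv x (g * h) = foxDeriv x g + MonoidAlgebra.of ℤ _ g * foxDeriv x h := by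
  unfold foxDeriv
  rw [map_mul, SemidirectProduct.mul_left, foxHom_right, toAdd_mul]
  rfl

end Fox

/-! ### The knot group of the double twist knot `J(k, 2n)` -/

/-- The first generator of the free group of rank two. -/
def a : FreeGroup (Fin 2) := FreeGroup.of 0

/-- The second generator of the free group of rank two. -/
def b : FreeGroup (Fin 2) := FreeGroup.of 1

/-- The word `w`: `(ba⁻¹)^m (b⁻¹a)^m` if `k = 2m`, and `(ba⁻¹)^m ba (b⁻¹a)^m` if `k = 2m + 1`. -/
def w (k : ℕ) : FreeGroup (Fin 2) :=
  if Even k then (b * a⁻¹) ^ (k / 2) * (b⁻¹ * a) ^ (k / 2)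
  else (b * a⁻¹) ^ (k / 2) * (b * a) * (b⁻¹ * a) ^ (k / 2)

/-- The relator `r = wⁿ a w⁻ⁿ b⁻¹`. -/
def r (k : ℕ) (n : ℤ) : FreeGroup (Fin 2) := w k ^ n * a * w k ^ (-n) * b⁻¹

/-- The knot group `⟨a, b ∣ wⁿ a = b wⁿ⟩` of `J(k, 2n)`. -/
abbrev KnotGroup (k : ℕ) (n : ℤ) : Type := PresentedGroup ({r k n} : Set (FreeGroup (Fin 2)))

/-- The projection of the free group on `a, b` onto the knot group. -/
def proj (k : ℕ) (n : ℤ) : FreeGroup (Fin 2) →* KnotGroup k n := PresentedGroup.mk _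

/-- The abelianization of the knot group: both meridians `a`, `b` go to the generator of `ℤ`. -/
def abel (k : ℕ) (n : ℤ) : KnotGroup k n →* Multiplicative ℤ :=
  PresentedGroup.toGroup (f := fun _ : Fin 2 => Multiplicative.ofAdd (1 : ℤ)) (by
    intro s hs
    rw [Set.mem_singleton_iff] at hs
    subst hs
    simp [r, a, b, mul_comm])

/-! ### Twisted Alexander polynomials -/

variable {k : ℕ} {n : ℤ} {d : ℕ}

/-- The tensor product `ρ ⊗ 𝔞`, on group elements: `g ↦ t^{𝔞(g)} ρ(g)`. -/
def tensorRep (ρ : KnotGroup k n →* SL(d, ℂ)) :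
    KnotGroup k n →* Matrix (Fin d) (Fin d) ℂ[T;T⁻¹] where
  toFun g := (LaurentPolynomial.T (Multiplicative.toAdd (abel k n g)) : ℂ[T;T⁻¹]) •
    (ρ g : Matrix (Fin d) (Fin d) ℂ).map LaurentPolynomial.C
  map_one' := by
    simp
  map_mul' g h := by
    rw [map_mul (abel k n), map_mul ρ, toAdd_mul, LaurentPolynomial.T_add, Matrix.SpecialLinearGroup.coe_mul,
      Matrix.map_mul, smul_mul_smul_comm]

/-- The ring homomorphism `Φ : ℤ[F] → ℤ[G] → M_d(ℂ[t, t⁻¹])`. -/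
def Phi (ρ : KnotGroup k n →* SL(d, ℂ)) :
    MonoidAlgebra ℤ (FreeGroup (Fin 2)) →ₐ[ℤ] Matrix (Fin d) (Fin d) ℂ[T;T⁻¹] :=
  MonoidAlgebra.lift ℤ _ _ ((tensorRep ρ).comp (proj k n))

/-- The twisted Alexander polynomial
`Δ^ρ(t) = det Φ(∂r/∂a) / det Φ(1 - b)`, a rational function of `t`. -/
def twistedAlexander (ρ : KnotGroup k n →* SL(d, ℂ)) : FractionRing ℂ[T;T⁻¹] :=
  algebraMap ℂ[T;T⁻¹] _ (Phi ρ (foxDeriv 0 (r k n))).det /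
    algebraMap ℂ[T;T⁻¹] _ (Phi ρ (1 - MonoidAlgebra.of ℤ _ b)).det

/-! ### The adjoint representation -/

/-- The vector space `sl₂(ℂ)` of trace-zero `2 × 2` complex matrices. -/
abbrev sl2 : Submodule ℂ (Matrix (Fin 2) (Fin 2) ℂ) :=
  LinearMap.ker (Matrix.traceLinearMap (Fin 2) ℂ ℂ)

/-- Coordinates of a trace-zero matrix in the basis `E = [0 1; 0 0]`, `H = [1 0; 0 -1]`,
`F = [0 0; 1 0]`. -/
def sl2Coord : sl2 ≃ₗ[ℂ] (Fin 3 → ℂ) where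
  toFun X := ![X.1 0 1, X.1 0 0, X.1 1 0]
  invFun v := ⟨!![v 1, v 0; v 2, -v 1], by
    simp [Matrix.trace_fin_two]⟩
  map_add' X Y := by
    ext i; fin_cases i <;> simp
  map_smul' c X := by
    ext i; fin_cases i <;> simp
  left_inv X := by
    have h : Matrix.trace X.1 = 0 := X.2
    rw [Matrix.trace_fin_two] at h
    have h2 : X.1 1 1 = -X.1 0 0 := by linear_combination h
    apply Subtype.ext
    ext i j
    fin_cases i <;> fin_cases j <;> simp [h2]
  right_inv v := by
    ext i; fin_cases i <;> simp

/-- The basis `(E, H, F)` of `sl₂(ℂ)`. -/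
def sl2Basis : Module.Basis (Fin 3) ℂ sl2 := Module.Basis.ofEquivFun sl2Coord

/-- The adjoint action `Ad(V)(g) = V g V⁻¹` as a linear endomorphism of `sl₂(ℂ)`. -/
def Ad : SL(2, ℂ) →* Module.End ℂ sl2 where
  toFun V :=
    { toFun := fun X =>
        ⟨(V : Matrix (Fin 2) (Fin 2) ℂ) * X.1 * ((V⁻¹ : SL(2, ℂ)) : Matrix (Fin 2) (Fin 2) ℂ), by
          have h : Matrix.trace X.1 = 0 := X.2
          change Matrix.trace ((V : Matrix (Fin 2) (Fin 2) ℂ) * X.1 *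
            ((V⁻¹ : SL(2, ℂ)) : Matrix (Fin 2) (Fin 2) ℂ)) = 0
          rw [Matrix.trace_mul_comm, ← mul_assoc, ← Matrix.SpecialLinearGroup.coe_mul]
          simpa using h⟩
      map_add' := fun X Y => by
        apply Subtype.ext
        simp [mul_add, add_mul]
      map_smul' := fun c X => by
        apply Subtype.ext
        simp }
  map_one' := by
    ext X : 1
    apply Subtype.ext
    simp
  map_mul' V U := by
    ext X : 1
    apply Subtype.ext
    simp [mul_assoc]

/-- The explicit matrix of `Ad(V)` in the basis `(E, H, F)`. -/
theorem toMatrix_Ad (V : SL(2, ℂ)) : LinearMap.toMatrix sl2Basis sl2Basis (Ad V) =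
    !![V.1 0 0 ^ 2, -2 * V.1 0 0 * V.1 0 1, -V.1 0 1 ^ 2;
       -V.1 0 0 * V.1 1 0, V.1 0 0 * V.1 1 1 + V.1 0 1 * V.1 1 0, V.1 0 1 * V.1 1 1;
       -V.1 1 0 ^ 2, 2 * V.1 1 0 * V.1 1 1, V.1 1 1 ^ 2] := by
  have hb : ∀ j, (sl2Basis j) = sl2Coord.symm (Pi.single j 1) := fun j => by
    simp [sl2Basis, Module.Basis.coe_ofEquivFun]
  ext i j
  rw [LinearMap.toMatrix_apply, hb]
  change sl2Coord (Ad V (sl2Coord.symm (Pi.single j 1))) i = _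
  fin_cases i <;> fin_cases j <;>
    simp [sl2Coord, Ad, Matrix.SpecialLinearGroup.coe_inv, Matrix.adjugate_fin_two,
      Matrix.mul_apply, Fin.sum_univ_two] <;> ring

theorem det_toMatrix_Ad (V : SL(2, ℂ)) :
    (LinearMap.toMatrix sl2Basis sl2Basis (Ad V)).det = 1 := by
  have h : V.1 0 0 * V.1 1 1 - V.1 0 1 * V.1 1 0 = 1 := by
    rw [← Matrix.det_fin_two]; exact V.2
  rw [toMatrix_Ad, Matrix.det_fin_three]
  simp only [Matrix.of_apply, Matrix.cons_val', Matrix.cons_val_zero, Matrix.cons_val_one,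
    Matrix.cons_val]
  generalize V.1 0 0 = p at *
  generalize V.1 0 1 = q at *
  generalize V.1 1 0 = s at *
  generalize V.1 1 1 = u at *
  have h3 : (p * u - q * s) ^ 3 = 1 := by rw [h, one_pow]
  linear_combination h3

/-- The adjoint action in the basis `(E, H, F)`, as a homomorphism `SL₂(ℂ) → SL₃(ℂ)`. -/
def AdSL : SL(2, ℂ) →* SL(3, ℂ) where
  toFun V := ⟨LinearMap.toMatrix sl2Basis sl2Basis (Ad V), det_toMatrix_Ad V⟩
  map_one' := by
    apply Subtype.ext
    simp [LinearMap.toMatrix_one]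
  map_mul' V U := by
    apply Subtype.ext
    change LinearMap.toMatrix sl2Basis sl2Basis (Ad (V * U)) =
      LinearMap.toMatrix sl2Basis sl2Basis (Ad V) * LinearMap.toMatrix sl2Basis sl2Basis (Ad U)
    rw [map_mul]
    exact LinearMap.toMatrix_mul _ _ _

/-- The adjoint twisted Alexander polynomial `Δ^{Ad ∘ ρ}(t)` of `J(k, 2n)`. -/
def adjointTwistedAlexander (ρ : KnotGroup k n →* SL(2, ℂ)) : FractionRing ℂ[T;T⁻¹] :=
  twistedAlexander (AdSL.comp ρ)

/-! ### Classes of representations, and traces -/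

/-- `ρ` is a (lift to `SL₂(ℂ)` of a) holonomy representation: the induced representation into
`PSL₂(ℂ)` is faithful, and the image is discrete.  Since `SL₂(ℂ) → PSL₂(ℂ)` has finite central
kernel, the image in `SL₂(ℂ)` is discrete if and only if the image in `PSL₂(ℂ)` is. -/
structure IsHolonomy (ρ : KnotGroup k n →* SL(2, ℂ)) : Prop where
  faithful : Function.Injective
    ((QuotientGroup.mk' (Subgroup.center SL(2, ℂ))).comp ρ : KnotGroup k n →* PSL(2, ℂ))
  discrete : DiscreteTopology ρ.range

/-- `ρ` is non-abelian and sends meridians to matrices of trace `±2`. -/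
structure IsNonabelianParabolic (ρ : KnotGroup k n →* SL(2, ℂ)) : Prop where
  nonabelian : ∃ g h, ρ g * ρ h ≠ ρ h * ρ g
  trace_meridian : (ρ (proj k n a)).1.trace = 2 ∨ (ρ (proj k n a)).1.trace = -2

/-- `y = tr ρ(ab⁻¹)`. -/
def yTrace (ρ : KnotGroup k n →* SL(2, ℂ)) : ℂ := (ρ (proj k n (a * b⁻¹))).1.trace

/-- `z = tr ρ(w)`. -/
def zTrace (ρ : KnotGroup k n →* SL(2, ℂ)) : ℂ := (ρ (proj k n (w k))).1.trace

/-- The value `S_l(v)` of the Chebyshev polynomial with `S_0 = 1`, `S_1 = v`,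
`S_l = v S_{l-1} - S_{l-2}` for all integers `l`. -/
def S (l : ℤ) (v : ℂ) : ℂ := (Polynomial.Chebyshev.S ℂ l).eval v

/-- The rational function `Δ` is a Laurent polynomial whose highest degree term is `c t^hi`
and whose lowest degree term is `e t^lo`, where `c` and `e` are nonzero. -/
def HasExtremeTerms (Δ : FractionRing ℂ[T;T⁻¹]) (c : ℂ) (hi : ℤ) (e : ℂ) (lo : ℤ) : Prop :=
  ∃ P : ℂ[T;T⁻¹], algebraMap ℂ[T;T⁻¹] (FractionRing ℂ[T;T⁻¹]) P = Δ ∧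
    c ≠ 0 ∧ e ≠ 0 ∧ P.coeff hi = c ∧ P.coeff lo = e ∧
    ∀ i : ℤ, P.coeff i ≠ 0 → lo ≤ i ∧ i ≤ hi

end DoubleTwist

end

/-! Write τ = Φ on group elements, x = ba⁻¹, and `n = -N`. Since wⁿaw⁻ⁿ = b in the knot group, Fox
calculus gives the numerator matrix M = τ(w⁻¹)^N − (1 − τ(b)) · (Σ_{i<N} τ(w⁻¹)^i) · τ(w⁻¹) · ∂w/∂a
(`fox_r_neg`). Its matrix coefficients of lowest and highest degree in t can be read off. Apart from
factors Ad(g) of determinant 1, each is a signed product of geometric sums of some Ad(g), and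
`det_geom` evaluates these: det Σ_{i<m} Ad(g)^i = m S_{m−1}(tr g)². If `k` is even, w has degree 0
and the extremes come from ∂w/∂a and from the factor 1 − τ(b). If `k` is odd, w has degree 2 and an
extra summand turns m terms into m + 1.

The meridians are parabolic, so the denominator is (1 − t)³ (`det_oneSub`). The fundamental formula
of Fox calculus, M(1 − τ(a)) = M′(1 − τ(b)), together with the fact that the images of a and b do
not commute, forces (1 − t)³ to divide det M (`dvd_det`). Division keeps the lowest coefficient, and
it lowers the top degree by 3 and changes the sign there.

The coefficients do not vanish because a zero of the relevant Chebyshev polynomial makes a power of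
x or w central. For even `k`, or for a zero in z, the knot relation then gives ρ(a) = ρ(b). For odd
`k` it becomes a torus knot relation, which is impossible since the roots of S_m are real and at
most 2.

It remains to see that a holonomy representation is parabolic on meridians. Otherwise the images of
the meridian and a longitude can be diagonalised together, and discreteness yields a relation aⁱλʲ =
1 with (i, j) ≠ (0, 0) (`exists_relation_of_discrete`). No such relation holds in the group
(`zpow_mul_longitude_eq_one`): over ℤ[u] modulo the Riley polynomial the peripheral elements have
explicit images, and reduction to characteristic 2, where all meridians become involutions, excludes
it. -/

noncomputable section

namespace DoubleTwist

/-! ### Extreme coefficients of Laurent polynomials -/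

section Lead

open LaurentPolynomial

/-- Substitution of `T^ε` into a polynomial. -/
def evalT (ε : ℤ) : Polynomial ℂ →ₐ[ℂ] ℂ[T;T⁻¹] := Polynomial.aeval (T ε)

/-- Coefficientwise substitution of `T^ε` into a matrix of polynomials. -/
def evalTMat (ε : ℤ) :
    Matrix (Fin 3) (Fin 3) (Polynomial ℂ) →+* Matrix (Fin 3) (Fin 3) ℂ[T;T⁻¹] :=
  (evalT ε : Polynomial ℂ →+* ℂ[T;T⁻¹]).mapMatrix

/-- The constant term of a matrix of polynomials. -/
def constMat : Matrix (Fin 3) (Fin 3) (Polynomial ℂ) →+* Matrix (Fin 3) (Fin 3) ℂ :=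
  (Polynomial.evalRingHom (0 : ℂ)).mapMatrix

/-- Scalar matrices inside matrices of Laurent polynomials. -/
def Cm : Matrix (Fin 3) (Fin 3) ℂ →+* Matrix (Fin 3) (Fin 3) ℂ[T;T⁻¹] :=
  (LaurentPolynomial.C : ℂ →+* ℂ[T;T⁻¹]).mapMatrix

/-- `M` equals `E T^{εe}` plus multiples of `T^{ε(e+1)}, T^{ε(e+2)}, …`. -/
def Lead (ε e : ℤ) (M : Matrix (Fin 3) (Fin 3) ℂ[T;T⁻¹]) (E : Matrix (Fin 3) (Fin 3) ℂ) : Prop :=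
  ∃ Q, M = (T (ε * e) : ℂ[T;T⁻¹]) • evalTMat ε Q ∧ constMat Q = E

theorem evalT_X (ε : ℤ) : evalT ε Polynomial.X = T ε := by simp [evalT]

theorem evalT_C (ε : ℤ) (c : ℂ) : evalT ε (Polynomial.C c) = LaurentPolynomial.C c := by
  rw [evalT, Polynomial.aeval_C, LaurentPolynomial.C_eq_algebraMap]

theorem evalTMat_smul (ε : ℤ) (p : Polynomial ℂ) (Q : Matrix (Fin 3) (Fin 3) (Polynomial ℂ)) :
    evalTMat ε (p • Q) = evalT ε p • evalTMat ε Q := by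
  ext1 i j; simp [evalTMat]

theorem constMat_smul (p : Polynomial ℂ) (Q : Matrix (Fin 3) (Fin 3) (Polynomial ℂ)) :
    constMat (p • Q) = p.eval 0 • constMat Q := by
  ext1 i j; simp [constMat]

theorem Lead.mul {ε e e' : ℤ} {M M' : Matrix (Fin 3) (Fin 3) ℂ[T;T⁻¹]}
    {E E' : Matrix (Fin 3) (Fin 3) ℂ} (h : Lead ε e M E) (h' : Lead ε e' M' E') :
    Lead ε (e + e') (M * M') (E * E') := by
  obtain ⟨Q, rfl, rfl⟩ := h
  obtain ⟨Q', rfl, rfl⟩ := h'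
  refine ⟨Q * Q', ?_, map_mul _ _ _⟩
  rw [map_mul, smul_mul_smul_comm, ← T_add, mul_add]

theorem Lead.add {ε e : ℤ} {M M' : Matrix (Fin 3) (Fin 3) ℂ[T;T⁻¹]}
    {E E' : Matrix (Fin 3) (Fin 3) ℂ} (h : Lead ε e M E) (h' : Lead ε e M' E') :
    Lead ε e (M + M') (E + E') := by
  obtain ⟨Q, rfl, rfl⟩ := h
  obtain ⟨Q', rfl, rfl⟩ := h'
  exact ⟨Q + Q', by rw [map_add, smul_add], map_add _ _ _⟩

theorem Lead.neg {ε e : ℤ} {M : Matrix (Fin 3) (Fin 3) ℂ[T;T⁻¹]}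
    {E : Matrix (Fin 3) (Fin 3) ℂ} (h : Lead ε e M E) : Lead ε e (-M) (-E) := by
  obtain ⟨Q, rfl, rfl⟩ := h
  exact ⟨-Q, by rw [map_neg, smul_neg], map_neg _ _⟩

/-- The leading matrix may be zero, so a summand of higher order can be declared at the order of the
dominant one. `Lead.add` then discards it. -/
theorem Lead.weaken {ε e e' : ℤ} {M : Matrix (Fin 3) (Fin 3) ℂ[T;T⁻¹]}
    {E : Matrix (Fin 3) (Fin 3) ℂ} (h : Lead ε e M E) (he : e' < e) : Lead ε e' M 0 := by
  obtain ⟨Q, rfl, rfl⟩ := h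
  obtain ⟨d, hd⟩ := Int.eq_ofNat_of_zero_le (sub_nonneg.2 he.le)
  have hd0 : d ≠ 0 := by rintro rfl; simp at hd; omega
  refine ⟨(Polynomial.X ^ d : Polynomial ℂ) • Q, ?_, ?_⟩
  · rw [evalTMat_smul, map_pow, evalT_X, T_pow, smul_smul, ← T_add]
    congr 2
    rw [← sub_add_cancel e e', hd]; ring
  · rw [constMat_smul]; simp [hd0]

theorem Lead.smul {ε e : ℤ} {M : Matrix (Fin 3) (Fin 3) ℂ[T;T⁻¹]}
    {E : Matrix (Fin 3) (Fin 3) ℂ} (h : Lead ε e M E) (f : ℤ) :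
    Lead ε (f + e) ((T (ε * f) : ℂ[T;T⁻¹]) • M) E := by
  obtain ⟨Q, rfl, rfl⟩ := h
  exact ⟨Q, by rw [smul_smul, ← T_add, mul_add], rfl⟩

theorem Lead.const (ε : ℤ) (E : Matrix (Fin 3) (Fin 3) ℂ) : Lead ε 0 (Cm E) E := by
  refine ⟨(Polynomial.C : ℂ →+* Polynomial ℂ).mapMatrix E, ?_, ?_⟩
  · rw [mul_zero, T_zero, one_smul]
    ext1 i j
    simp [evalTMat, Cm, evalT_C]
  · ext1 i j
    simp [constMat]

theorem Lead.pow {ε e : ℤ} {M : Matrix (Fin 3) (Fin 3) ℂ[T;T⁻¹]}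
    {E : Matrix (Fin 3) (Fin 3) ℂ} (h : Lead ε e M E) (n : ℕ) :
    Lead ε (n * e) (M ^ n) (E ^ n) := by
  induction n with
  | zero => simpa using Lead.const ε 1
  | succ n ih =>
    rw [pow_succ, pow_succ]
    convert! ih.mul h using 1
    push_cast; ring

/-- Geometric sums of a matrix of positive order. -/
theorem Lead.geom_pos {ε e : ℤ} {M : Matrix (Fin 3) (Fin 3) ℂ[T;T⁻¹]}
    {E : Matrix (Fin 3) (Fin 3) ℂ} (h : Lead ε e M E) (he : 0 < e) (n : ℕ) :
    Lead ε 0 (∑ i ∈ Finset.range (n + 1), M ^ i) 1 := by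
  induction n with
  | zero => simpa using Lead.const ε 1
  | succ n ih =>
    rw [Finset.sum_range_succ]
    simpa using ih.add ((h.pow (n + 1)).weaken (e' := 0) (by positivity))

/-- Geometric sums of a matrix of negative order. -/
theorem Lead.geom_neg {ε e : ℤ} {M : Matrix (Fin 3) (Fin 3) ℂ[T;T⁻¹]}
    {E : Matrix (Fin 3) (Fin 3) ℂ} (h : Lead ε e M E) (he : e < 0) (n : ℕ) :
    Lead ε (n * e) (∑ i ∈ Finset.range (n + 1), M ^ i) (E ^ n) := by
  induction n with
  | zero => simpa using Lead.const ε 1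
  | succ n ih =>
    rw [Finset.sum_range_succ]
    have := (ih.weaken (e' := ((n + 1 : ℕ) : ℤ) * e) (by push_cast; linarith)).add (h.pow (n + 1))
    simpa using this

/-- The determinant commutes with the two ring homomorphisms "substitute T^ε" and "take the constant
term"; the scalar power of T is cubed because the matrices are 3 × 3. -/
theorem Lead.det {ε e : ℤ} {M : Matrix (Fin 3) (Fin 3) ℂ[T;T⁻¹]}
    {E : Matrix (Fin 3) (Fin 3) ℂ} (h : Lead ε e M E) :
    ∃ q : Polynomial ℂ, M.det = T (ε * (3 * e)) * evalT ε q ∧ q.coeff 0 = E.det := by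
  obtain ⟨Q, rfl, rfl⟩ := h
  refine ⟨Q.det, ?_, ?_⟩
  · rw [Matrix.det_smul, Fintype.card_fin, T_pow]
    congr 1
    · congr 1; push_cast; ring
    · exact (RingHom.map_det (evalT ε : Polynomial ℂ →+* ℂ[T;T⁻¹]) Q).symm
  · rw [Polynomial.coeff_zero_eq_eval_zero]
    exact RingHom.map_det (Polynomial.evalRingHom (0 : ℂ)) Q

theorem coeff_T_mul (e i : ℤ) (f : ℂ[T;T⁻¹]) : (T e * f).coeff i = f.coeff (i - e) := by
  induction f using LaurentPolynomial.induction_on' with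
  | add p q hp hq =>
    rw [mul_add, AddMonoidAlgebra.coeff_add, Finsupp.add_apply, hp, hq,
      AddMonoidAlgebra.coeff_add, Finsupp.add_apply]
  | C_mul_T n c =>
    rw [mul_left_comm, ← T_add, ← single_eq_C_mul_T, ← single_eq_C_mul_T]
    simp only [AddMonoidAlgebra.coeff_single, Finsupp.single_apply]
    congr 1
    exact propext ⟨fun h => by omega, fun h => by omega⟩

theorem coeff_evalT (ε : ℤ) (hε : ε * ε = 1) (q : Polynomial ℂ) (i : ℤ) :
    (evalT ε q).coeff i = if 0 ≤ ε * i then q.coeff (ε * i).toNat else 0 := by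
  induction q using Polynomial.induction_on' with
  | add p q hp hq =>
    rw [map_add, AddMonoidAlgebra.coeff_add, Finsupp.add_apply, hp, hq]
    split_ifs <;> simp
  | monomial n c =>
    rw [← Polynomial.C_mul_X_pow_eq_monomial, map_mul, map_pow, evalT_C, evalT_X, T_pow,
      ← single_eq_C_mul_T, AddMonoidAlgebra.coeff_single, Finsupp.single_apply,
      Polynomial.coeff_C_mul_X_pow]
    rcases mul_self_eq_one_iff.1 hε with rfl | rfl
    · by_cases h : (n : ℤ) * 1 = i
      · have h2 : i.toNat = n := by omega
        have h3 : 0 ≤ i := by omega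
        simp [h, h2, h3]
      · have h2 : 0 ≤ i → i.toNat ≠ n := by omega
        rw [if_neg h]
        split_ifs with h3 h4
        · exact absurd h4 (by simpa using h2 (by simpa using h3))
        · rfl
        · rfl
    · by_cases h : (n : ℤ) * -1 = i
      · have h2 : (-i).toNat = n := by omega
        have h3 : i ≤ 0 := by omega
        simp [h, h2, h3]
      · have h2 : i ≤ 0 → (-i).toNat ≠ n := by omega
        rw [if_neg h]
        split_ifs with h3 h4
        · exact absurd (by simpa using h4) (h2 (by simpa using h3))
        · rfl
        · rfl

/-- With ε = 1 this controls the bottom of the determinant, with ε = −1 the top. -/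
theorem Lead.coeff_det {ε e : ℤ} (hε : ε * ε = 1) {M : Matrix (Fin 3) (Fin 3) ℂ[T;T⁻¹]}
    {E : Matrix (Fin 3) (Fin 3) ℂ} (h : Lead ε e M E) :
    M.det.coeff (ε * (3 * e)) = E.det ∧ ∀ i, ε * i < 3 * e → M.det.coeff i = 0 := by
  obtain ⟨q, hq, hq0⟩ := h.det
  constructor
  · rw [hq, coeff_T_mul, coeff_evalT _ hε]; simp [hq0]
  · intro i hi
    rw [hq, coeff_T_mul, coeff_evalT _ hε, if_neg]
    have : ε * (i - ε * (3 * e)) = ε * i - 3 * e := by linear_combination (-3 * e) * hε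
    omega

end Lead

/-! ### Dividing a Laurent polynomial by (1 − T)³. -/

section Divide

open LaurentPolynomial

theorem coeff_mul_one_sub_T (f : ℂ[T;T⁻¹]) (i : ℤ) :
    (f * (1 - T 1)).coeff i = f.coeff i - f.coeff (i - 1) := by
  rw [mul_sub, mul_one, mul_comm f, AddMonoidAlgebra.coeff_sub, Finsupp.sub_apply, coeff_T_mul]

/-- Division by `1 - T` shortens the support by one. -/
theorem support_of_mul_one_sub_T {f : ℂ[T;T⁻¹]} {lo hi : ℤ}
    (hlo : ∀ i < lo, (f * (1 - T 1)).coeff i = 0)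
    (hhi : ∀ i > hi + 1, (f * (1 - T 1)).coeff i = 0) :
    (∀ i < lo, f.coeff i = 0) ∧ ∀ i > hi, f.coeff i = 0 := by
  simp only [coeff_mul_one_sub_T, sub_eq_zero] at hlo hhi
  have hfin : (Function.support f.coeff).Finite := f.coeff.hasFiniteSupport
  constructor
  · intro i hi
    by_contra h
    -- Where the product has no coefficient, consecutive coefficients of f agree. A nonzero one
    -- would therefore repeat forever, against finite support.
    have key : ∀ n : ℕ, f.coeff (i - n) ≠ 0 := by
      intro n
      induction n with
      | zero => simpa using h
      | succ n ih =>
        rw [hlo (i - n) (by omega)] at ih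
        push_cast
        rwa [← sub_sub]
    exact (Set.infinite_of_injective_forall_mem (f := fun n : ℕ => i - (n : ℤ))
      (fun a b hab => by simpa using hab) key) hfin
  · intro i hi
    by_contra h
    have key : ∀ n : ℕ, f.coeff (i + n) ≠ 0 := by
      intro n
      induction n with
      | zero => simpa using h
      | succ n ih =>
        have := hhi (i + (n + 1 : ℕ)) (by push_cast; omega)
        rw [this]
        push_cast
        rwa [← add_assoc, add_sub_cancel_right]
    exact (Set.infinite_of_injective_forall_mem (f := fun n : ℕ => i + (n : ℤ))
      (fun a b hab => by simpa using hab) key) hfin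

/-- The extreme coefficients of `f` from those of `f (1 - T)`. -/
theorem extreme_of_mul_one_sub_T {f : ℂ[T;T⁻¹]} {lo hi : ℤ} {c d : ℂ}
    (hlo : ∀ i < lo, (f * (1 - T 1)).coeff i = 0)
    (hhi : ∀ i > hi + 1, (f * (1 - T 1)).coeff i = 0)
    (hc : (f * (1 - T 1)).coeff (hi + 1) = c) (hd : (f * (1 - T 1)).coeff lo = d) :
    (∀ i < lo, f.coeff i = 0) ∧ (∀ i > hi, f.coeff i = 0) ∧ f.coeff hi = -c ∧ f.coeff lo = d := by
  obtain ⟨h1, h2⟩ := support_of_mul_one_sub_T hlo hhi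
  refine ⟨h1, h2, ?_, ?_⟩
  · rw [← hc, coeff_mul_one_sub_T, h2 (hi + 1) (by omega)]; simp
  · rw [← hd, coeff_mul_one_sub_T, h1 (lo - 1) (by omega)]; simp

/-- Each factor 1 − T contributes −T at the top and 1 at the bottom, whence three degrees and the
sign (−1)³ at the top only. -/
theorem extreme_of_mul_one_sub_T_pow_three {f : ℂ[T;T⁻¹]} {lo hi : ℤ} {c d : ℂ}
    (hlo : ∀ i < lo, (f * (1 - T 1) ^ 3).coeff i = 0)
    (hhi : ∀ i > hi + 3, (f * (1 - T 1) ^ 3).coeff i = 0)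
    (hc : (f * (1 - T 1) ^ 3).coeff (hi + 3) = c) (hd : (f * (1 - T 1) ^ 3).coeff lo = d) :
    (∀ i < lo, f.coeff i = 0) ∧ (∀ i > hi, f.coeff i = 0) ∧ f.coeff hi = -c ∧ f.coeff lo = d := by
  have e : f * (1 - T 1) ^ 3 = f * (1 - T 1) * (1 - T 1) * (1 - T 1) := by ring
  rw [e] at hlo hhi hc hd
  obtain ⟨a1, a2, a3, a4⟩ := extreme_of_mul_one_sub_T (hi := hi + 2) (c := c) hlo
    (fun i hi => hhi i (by omega)) (by rw [← hc, show hi + 2 + 1 = hi + 3 by ring]) hd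
  obtain ⟨b1, b2, b3, b4⟩ := extreme_of_mul_one_sub_T (hi := hi + 1) (c := -c) a1
    (fun i hi => a2 i (by omega)) (by rw [← a3, show hi + 1 + 1 = hi + 2 by ring]) a4
  obtain ⟨c1, c2, c3, c4⟩ := extreme_of_mul_one_sub_T (hi := hi) b1
    (fun i hi => b2 i (by omega)) b3 b4
  exact ⟨c1, c2, by rw [c3]; ring, c4⟩

end Divide

/-! ### Matrices in `SL₂(ℂ)` and their adjoint action -/

section SL2

theorem coe_AdSL (V : SL(2, ℂ)) : (AdSL V).1 =
    !![V.1 0 0 ^ 2, -2 * V.1 0 0 * V.1 0 1, -V.1 0 1 ^ 2;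
       -V.1 0 0 * V.1 1 0, V.1 0 0 * V.1 1 1 + V.1 0 1 * V.1 1 0, V.1 0 1 * V.1 1 1;
       -V.1 1 0 ^ 2, 2 * V.1 1 0 * V.1 1 1, V.1 1 1 ^ 2] :=
  toMatrix_Ad V

theorem exists_add_inv_eq (t : ℂ) : ∃ s : ℂ, s ≠ 0 ∧ s + s⁻¹ = t := by
  obtain ⟨s, hs⟩ := IsAlgClosed.exists_pow_nat_eq (t ^ 2 - 4) (n := 2) (by norm_num)
  have h : (t + s) / 2 * ((t - s) / 2) = 1 := by linear_combination (-1 / 4 : ℂ) * hs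
  refine ⟨(t + s) / 2, left_ne_zero_of_mul_eq_one h, ?_⟩
  rw [inv_eq_of_mul_eq_one_right h]; ring

theorem det_eq_one (g : SL(2, ℂ)) : g.1 0 0 * g.1 1 1 - g.1 0 1 * g.1 1 0 = 1 := by
  rw [← Matrix.det_fin_two]; exact g.2

/-- Every matrix in `SL₂(ℂ)` is conjugate to an upper triangular one. -/
theorem exists_conj_upper (g : SL(2, ℂ)) : ∃ (h t : SL(2, ℂ)), g = h * t * h⁻¹ ∧ t.1 1 0 = 0 := by
  by_cases hg : g.1 1 0 = 0
  · exact ⟨1, g, by simp, hg⟩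
  obtain ⟨s, hs, hst⟩ := exists_add_inv_eq (g.1 0 0 + g.1 1 1)
  have hd := det_eq_one g
  set x := g.1 1 0 with hx
  -- The first column is an eigenvector of g for the eigenvalue s; the second is chosen to make the
  -- determinant 1.
  let h : SL(2, ℂ) := ⟨!![s - g.1 1 1, -x⁻¹; x, 0], by rw [Matrix.det_fin_two_of]; field_simp; ring⟩
  refine ⟨h, h⁻¹ * g * h, by group, ?_⟩
  have hs2 : s * s - (g.1 0 0 + g.1 1 1) * s + 1 = 0 := by
    rw [← hst]; field_simp; ring
  rw [Matrix.SpecialLinearGroup.coe_mul, Matrix.SpecialLinearGroup.coe_mul,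
    Matrix.SpecialLinearGroup.coe_inv, Matrix.adjugate_fin_two]
  simp only [h, Matrix.mul_apply, Fin.sum_univ_two, Matrix.of_apply, Matrix.cons_val',
    Matrix.cons_val_zero, Matrix.cons_val_one, Matrix.cons_val_fin_one]
  rw [← hx]
  linear_combination x * hs2 + x * hd

theorem trace_conj (h t : SL(2, ℂ)) : (h * t * h⁻¹).1.trace = t.1.trace := by
  rw [Matrix.SpecialLinearGroup.coe_mul, Matrix.trace_mul_comm,
    ← Matrix.SpecialLinearGroup.coe_mul, inv_mul_cancel_left]

theorem trace_inv (g : SL(2, ℂ)) : (g⁻¹).1.trace = g.1.trace := by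
  rw [Matrix.SpecialLinearGroup.coe_inv, Matrix.adjugate_fin_two]
  simp [Matrix.trace_fin_two, add_comm]

/-- S_m(s + s⁻¹) is the sum s^m + s^{m−2} + ⋯ + s^{−m}. Splitting off its last term avoids dividing
by s − s⁻¹, so s = ±1 is included. -/
theorem S_natCast_succ (s : ℂ) (hs : s ≠ 0) (m : ℕ) :
    S m (s + s⁻¹) = s * S ((m : ℤ) - 1) (s + s⁻¹) + (s⁻¹) ^ m := by
  induction m with
  | zero => simp [S]
  | succ m ih =>
    have h : S ((m + 1 : ℕ) : ℤ) (s + s⁻¹) =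
        (s + s⁻¹) * S m (s + s⁻¹) - S ((m : ℤ) - 1) (s + s⁻¹) := by
      simp [S, Polynomial.Chebyshev.S_add_one]
    have h1 : (((m + 1 : ℕ) : ℤ) - 1) = m := by push_cast; ring
    rw [h, h1]
    have h2 : s⁻¹ * S m (s + s⁻¹) = S ((m : ℤ) - 1) (s + s⁻¹) + (s⁻¹) ^ (m + 1) := by
      rw [ih, mul_add, inv_mul_cancel_left₀ hs, pow_succ']
    linear_combination h2

theorem sum_sq_pow (s : ℂ) (hs : s ≠ 0) (m : ℕ) :
    s * ∑ i ∈ Finset.range m, (s ^ 2) ^ i = s ^ m * S ((m : ℤ) - 1) (s + s⁻¹) := by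
  induction m with
  | zero => simp [S]
  | succ m ih =>
    have h1 : (((m + 1 : ℕ) : ℤ) - 1) = m := by push_cast; ring
    have h2 := S_natCast_succ s⁻¹ (inv_ne_zero hs) m
    rw [inv_inv, add_comm] at h2
    rw [Finset.sum_range_succ, mul_add, ih, h1, h2]
    have h3 : s * s⁻¹ = 1 := mul_inv_cancel₀ hs
    linear_combination (-s ^ m * S ((m : ℤ) - 1) (s + s⁻¹)) * h3

theorem geom_upper_entries {X : Matrix (Fin 3) (Fin 3) ℂ} (h10 : X 1 0 = 0) (h20 : X 2 0 = 0)
    (h21 : X 2 1 = 0) (m : ℕ) : (X ^ m) 1 0 = 0 ∧ (X ^ m) 2 0 = 0 ∧ (X ^ m) 2 1 = 0 ∧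
      ∀ i, (X ^ m) i i = X i i ^ m := by
  induction m with
  | zero => simp
  | succ m ih =>
    obtain ⟨a1, a2, a3, a4⟩ := ih
    have b0 := a4 0
    have b1 := a4 1
    have b2 := a4 2
    refine ⟨?_, ?_, ?_, ?_⟩
    · simp [pow_succ, Matrix.mul_apply, Fin.sum_univ_three, h10, h20, a1]
    · simp [pow_succ, Matrix.mul_apply, Fin.sum_univ_three, h10, h20, a2]
    · simp [pow_succ, Matrix.mul_apply, Fin.sum_univ_three, h21, a2, a3]
    · intro i
      fin_cases i
      · simp [pow_succ, Matrix.mul_apply, Fin.sum_univ_three, h10, h20, b0]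
      · simp [pow_succ, Matrix.mul_apply, Fin.sum_univ_three, h21, a1, b1]
      · simp [pow_succ, Matrix.mul_apply, Fin.sum_univ_three, a2, a3, b2]

/-- The adjoint matrix is upper triangular with diagonal s², 1, s⁻². The middle eigenvalue
contributes m, and the two outer geometric sums multiply to the square of S_{m−1}. -/
theorem det_geom_upper (t : SL(2, ℂ)) (ht : t.1 1 0 = 0) (m : ℕ) :
    (∑ i ∈ Finset.range m, (AdSL t).1 ^ i).det = m * S ((m : ℤ) - 1) t.1.trace ^ 2 := by
  have hd := det_eq_one t
  rw [ht, mul_zero, sub_zero] at hd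
  have hu : t.1 1 1 = (t.1 0 0)⁻¹ := (inv_eq_of_mul_eq_one_right hd).symm
  have hs : t.1 0 0 ≠ 0 := left_ne_zero_of_mul_eq_one hd
  generalize hS : t.1 0 0 = s at *
  have e := coe_AdSL t
  rw [ht, hu, hS] at e
  have k := fun m => geom_upper_entries (X := (AdSL t).1) (by simp [e]) (by simp [e])
    (by simp [e]) m
  have d0 : (AdSL t).1 0 0 = s ^ 2 := by simp [e]
  have d1 : (AdSL t).1 1 1 = 1 := by simp [e, hs]
  have d2 : (AdSL t).1 2 2 = (s⁻¹) ^ 2 := by simp [e]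
  rw [Matrix.det_fin_three]
  simp only [Matrix.sum_apply, (k _).1, (k _).2.1, (k _).2.2.1, (k _).2.2.2, d0, d1, d2,
    Finset.sum_const_zero, mul_zero, sub_zero, add_zero, zero_mul]
  have h1 := sum_sq_pow s hs m
  have h2 := sum_sq_pow s⁻¹ (inv_ne_zero hs) m
  rw [inv_inv, add_comm] at h2
  rw [Matrix.trace_fin_two, hS, hu]
  simp only [one_pow, Finset.sum_const, Finset.card_range, nsmul_eq_mul, mul_one]
  have h3 : (∑ i ∈ Finset.range m, (s ^ 2) ^ i) * (∑ i ∈ Finset.range m, ((s⁻¹) ^ 2) ^ i) =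
      S ((m : ℤ) - 1) (s + s⁻¹) ^ 2 := by
    calc _ = (s * ∑ i ∈ Finset.range m, (s ^ 2) ^ i) *
          (s⁻¹ * ∑ i ∈ Finset.range m, ((s⁻¹) ^ 2) ^ i) := by field_simp
      _ = _ := by rw [h1, h2, inv_pow]; field_simp
  rw [← h3]; ring

/-- `det (1 + Ad g + ⋯ + Ad g ^ (m - 1)) = m S_{m-1}(tr g)²`. -/
theorem det_geom (g : SL(2, ℂ)) (m : ℕ) :
    (∑ i ∈ Finset.range m, (AdSL g).1 ^ i).det = m * S ((m : ℤ) - 1) g.1.trace ^ 2 := by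
  obtain ⟨h, t, rfl, ht⟩ := exists_conj_upper g
  rw [trace_conj, ← det_geom_upper t ht]
  have e : ∀ i : ℕ, (AdSL (h * t * h⁻¹)).1 ^ i = (AdSL h).1 * (AdSL t).1 ^ i * (AdSL h⁻¹).1 := by
    intro i
    rw [← Matrix.SpecialLinearGroup.coe_pow, ← Matrix.SpecialLinearGroup.coe_pow,
      ← Matrix.SpecialLinearGroup.coe_mul, ← Matrix.SpecialLinearGroup.coe_mul, ← map_pow,
      conj_pow, map_mul, map_mul, map_pow]
  simp only [e]
  have d1 : (AdSL h).1.det = 1 := (AdSL h).2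
  have d2 : ((AdSL h⁻¹ : SL(3, ℂ)) : Matrix (Fin 3) (Fin 3) ℂ).det = 1 := (AdSL h⁻¹).2
  rw [← Finset.sum_mul, ← Finset.mul_sum, Matrix.det_mul, Matrix.det_mul, d1, d2, one_mul,
    mul_one]

end SL2

/-! ### The operators 1 − t Ad(V) and divisibility by (1 − t)³. -/

section OneSub

open LaurentPolynomial

theorem Cm_AdSL_mul (V U : SL(2, ℂ)) :
    Cm (AdSL (V * U)).1 = Cm (AdSL V).1 * Cm (AdSL U).1 := by
  rw [← map_mul Cm, map_mul AdSL]; rfl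

theorem Cm_AdSL_one : Cm (AdSL 1).1 = 1 := by
  rw [← map_one Cm, map_one AdSL]; rfl

theorem det_Cm_AdSL (V : SL(2, ℂ)) : (Cm (AdSL V).1).det = 1 := by
  have := RingHom.map_det (LaurentPolynomial.C : ℂ →+* ℂ[T;T⁻¹]) (AdSL V).1
  rw [Cm, ← this, (AdSL V).2, map_one]

theorem det_conj_Cm (V : SL(2, ℂ)) (M : Matrix (Fin 3) (Fin 3) ℂ[T;T⁻¹]) :
    (Cm (AdSL V).1 * M * Cm (AdSL V⁻¹).1).det = M.det := by
  rw [Matrix.det_mul, Matrix.det_mul, det_Cm_AdSL, det_Cm_AdSL, one_mul, mul_one]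

/-- The operator `1 - t Ad(V)`. -/
def oneSub (V : SL(2, ℂ)) : Matrix (Fin 3) (Fin 3) ℂ[T;T⁻¹] :=
  1 - (T 1 : ℂ[T;T⁻¹]) • Cm (AdSL V).1

theorem oneSub_conj (h V : SL(2, ℂ)) :
    oneSub (h * V * h⁻¹) = Cm (AdSL h).1 * oneSub V * Cm (AdSL h⁻¹).1 := by
  rw [oneSub, oneSub, Cm_AdSL_mul, Cm_AdSL_mul, mul_sub, sub_mul, mul_one, ← Cm_AdSL_mul,
    ← Cm_AdSL_mul, ← Cm_AdSL_mul, mul_inv_cancel, Cm_AdSL_one, mul_smul_comm, smul_mul_assoc,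
    Cm_AdSL_mul (h * V)]
  rw [Cm_AdSL_mul h V]

theorem diag_of_trace {t : SL(2, ℂ)} (ht : t.1 1 0 = 0)
    (h2 : t.1.trace = 2 ∨ t.1.trace = -2) : t.1 1 1 = t.1 0 0 ∧ t.1 0 0 ^ 2 = 1 := by
  have hd := det_eq_one t
  rw [ht, mul_zero, sub_zero] at hd
  rw [Matrix.trace_fin_two] at h2
  rcases h2 with h2 | h2
  · have : t.1 0 0 = 1 := by
      have : (t.1 0 0 - 1) ^ 2 = 0 := by linear_combination t.1 0 0 * h2 - hd
      exact sub_eq_zero.1 (pow_eq_zero_iff (two_ne_zero) |>.1 this)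
    rw [this] at h2 ⊢
    exact ⟨by linear_combination h2, by norm_num⟩
  · have : t.1 0 0 = -1 := by
      have : (t.1 0 0 + 1) ^ 2 = 0 := by linear_combination t.1 0 0 * h2 - hd
      exact eq_neg_of_add_eq_zero_left (pow_eq_zero_iff (two_ne_zero) |>.1 this)
    rw [this] at h2 ⊢
    exact ⟨by linear_combination h2, by norm_num⟩

theorem oneSub_upper {t : SL(2, ℂ)} {ε q : ℂ} (h00 : t.1 0 0 = ε) (h01 : t.1 0 1 = q)
    (h10 : t.1 1 0 = 0) (h11 : t.1 1 1 = ε) (hε : ε ^ 2 = 1) :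
    oneSub t = !![1 - T 1, T 1 * C (2 * ε * q), T 1 * C (q ^ 2);
      0, 1 - T 1, - (T 1 * C (ε * q)); 0, 0, 1 - T 1] := by
  have hε' : ε * ε = 1 := by rw [← hε, sq]
  rw [oneSub, coe_AdSL, h00, h01, h10, h11]
  ext1 i j
  fin_cases i <;> fin_cases j <;> simp [Cm, hε, hε']
  exact Or.inl (mul_comm _ _)

/-- The adjoint of a parabolic element is unipotent, so the triangularised operator has 1 − T along
its diagonal. -/
theorem det_oneSub {V : SL(2, ℂ)} (h2 : V.1.trace = 2 ∨ V.1.trace = -2) :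
    (oneSub V).det = (1 - T 1) ^ 3 := by
  obtain ⟨h, t, rfl, ht⟩ := exists_conj_upper V
  rw [trace_conj] at h2
  obtain ⟨h11, hε⟩ := diag_of_trace ht h2
  rw [oneSub_conj, det_conj_Cm, oneSub_upper rfl rfl ht h11 hε, Matrix.det_fin_three]
  simp
  ring

theorem isCoprime_of_sub_dvd {x f : ℂ[T;T⁻¹]} {c : ℂ} (hc : c ≠ 0) (h : x ∣ f - C c) :
    IsCoprime x f := by
  obtain ⟨g, hg⟩ := h
  refine ⟨-(C c⁻¹) * g, C c⁻¹, ?_⟩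
  have h1 : C c⁻¹ * C c = (1 : ℂ[T;T⁻¹]) := by rw [← map_mul, inv_mul_cancel₀ hc, map_one]
  linear_combination C c⁻¹ * hg + h1

/-- Find a vector γ with Mγ divisible by (1 − T)³ and one coordinate prime to 1 − T. Multiplying by
the adjugate of M gives (1 − T)³ ∣ det M · γ, and that coordinate can be cancelled. -/
theorem dvd_det_upper {α t : SL(2, ℂ)} {ε q : ℂ} (h00 : t.1 0 0 = ε) (h01 : t.1 0 1 = q)
    (h10 : t.1 1 0 = 0) (h11 : t.1 1 1 = ε) (hε : ε ^ 2 = 1) (hq : q ≠ 0) (hα : α.1 1 0 ≠ 0)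
    {M M' : Matrix (Fin 3) (Fin 3) ℂ[T;T⁻¹]} (hM : M * oneSub α = M' * oneSub t) :
    (1 - T 1 : ℂ[T;T⁻¹]) ^ 3 ∣ M.det := by
  -- This is the last column of the adjugate of `oneSub t`.
  let β : Fin 3 → ℂ[T;T⁻¹] :=
    ![-(C (q ^ 2) * (T 1 ^ 2 + T 1)), C (ε * q) * T 1 * (1 - T 1), (1 - T 1) ^ 2]
  have hβ : (oneSub t).mulVec β = (1 - T 1 : ℂ[T;T⁻¹]) ^ 3 • ![0, 0, 1] := by
    have e1 : C ε * C ε = (1 : ℂ[T;T⁻¹]) := by rw [← map_mul, ← sq, hε, map_one]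
    rw [oneSub_upper h00 h01 h10 h11 hε]
    ext1 i
    fin_cases i
    · simp [β, Matrix.mulVec, dotProduct, Fin.sum_univ_three, -T_pow]
      have e2 : (C 2 : ℂ[T;T⁻¹]) = 2 := map_ofNat C 2
      rw [e2]
      linear_combination 2 * C q ^ 2 * T 1 ^ 2 * (1 - T 1) * e1
    · simp [β, Matrix.mulVec, dotProduct, Fin.sum_univ_three, -T_pow]
      ring
    · simp [β, Matrix.mulVec, dotProduct, Fin.sum_univ_three, -T_pow]
      ring
  set γ := (oneSub α).mulVec β with hγ
  have hMγ : M.mulVec γ = (1 - T 1 : ℂ[T;T⁻¹]) ^ 3 • M'.mulVec ![0, 0, 1] := by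
    rw [hγ, Matrix.mulVec_mulVec, hM, ← Matrix.mulVec_mulVec, hβ, Matrix.mulVec_smul]
  have hdet : M.det • γ = (1 - T 1 : ℂ[T;T⁻¹]) ^ 3 • M.adjugate.mulVec (M'.mulVec ![0, 0, 1]) := by
    rw [← Matrix.mulVec_smul M.adjugate, ← hMγ, Matrix.mulVec_mulVec, Matrix.adjugate_mul,
      Matrix.smul_mulVec, Matrix.one_mulVec]
  have hγ2 : γ 2 = T 1 * (C (α.1 1 0 ^ 2) * β 0 - C (2 * α.1 1 0 * α.1 1 1) * β 1
      - C (α.1 1 1 ^ 2) * β 2) + β 2 := by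
    rw [hγ, oneSub, coe_AdSL]
    simp [Matrix.mulVec, dotProduct, Fin.sum_univ_three, Cm]
    ring
  have hcop : IsCoprime (1 - T 1 : ℂ[T;T⁻¹]) (γ 2) := by
    -- The constant is the value of γ 2 at T = 1, where β reduces to (−2q², 0, 0).
    refine isCoprime_of_sub_dvd (c := -2 * α.1 1 0 ^ 2 * q ^ 2) (by simp [hα, hq]) ?_
    rw [hγ2]
    refine ⟨C (α.1 1 0) ^ 2 * C q ^ 2 * (2 + 2 * T 1 + T 1 ^ 2)
      - T 1 * (C (2 * α.1 1 0 * α.1 1 1) * C (ε * q) * T 1)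
      - T 1 * (C (α.1 1 1 ^ 2) * (1 - T 1)) + (1 - T 1), ?_⟩
    simp only [β, Matrix.cons_val_zero, Matrix.cons_val_one, Matrix.cons_val, map_mul, map_pow,
      map_neg, map_ofNat]
    ring
  have h := congrFun hdet 2
  simp only [Pi.smul_apply, smul_eq_mul] at h
  exact (IsCoprime.pow_left hcop).dvd_of_dvd_mul_right ⟨_, h⟩

/-- If `M (1 - t Ad α) = M' (1 - t Ad β)` with `β` parabolic and not commuting with `α`, of the
same trace, then `(1 - t)³` divides `det M`. -/
theorem dvd_det {α β : SL(2, ℂ)} (htr : α.1.trace = β.1.trace)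
    (h2 : β.1.trace = 2 ∨ β.1.trace = -2) (hne : α * β ≠ β * α)
    {M M' : Matrix (Fin 3) (Fin 3) ℂ[T;T⁻¹]} (hM : M * oneSub α = M' * oneSub β) :
    (1 - T 1 : ℂ[T;T⁻¹]) ^ 3 ∣ M.det := by
  obtain ⟨h, t, rfl, ht⟩ := exists_conj_upper β
  obtain ⟨α, rfl⟩ : ∃ α', α = h * α' * h⁻¹ := ⟨h⁻¹ * α * h, by group⟩
  have hne' : α * t ≠ t * α := by
    intro H
    apply hne
    calc h * α * h⁻¹ * (h * t * h⁻¹) = h * (α * t) * h⁻¹ := by group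
      _ = h * t * h⁻¹ * (h * α * h⁻¹) := by rw [H]; group
  simp only [trace_conj] at htr h2
  obtain ⟨h11, hε⟩ := diag_of_trace ht h2
  have hq : t.1 0 1 ≠ 0 := by
    intro hq
    apply hne'
    apply Subtype.ext
    rw [Matrix.SpecialLinearGroup.coe_mul, Matrix.SpecialLinearGroup.coe_mul]
    ext i j
    fin_cases i <;> fin_cases j <;>
      simp [Matrix.mul_apply, Fin.sum_univ_two, hq, ht, h11, mul_comm]
  -- Otherwise α and t are both upper triangular with the same scalar diagonal, hence commute.
  have hα : α.1 1 0 ≠ 0 := by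
    intro hα
    obtain ⟨k11, -⟩ := diag_of_trace hα (htr ▸ h2)
    apply hne'
    apply Subtype.ext
    rw [Matrix.SpecialLinearGroup.coe_mul, Matrix.SpecialLinearGroup.coe_mul]
    have e0 : α.1 0 0 = t.1 0 0 := by
      rw [Matrix.trace_fin_two, Matrix.trace_fin_two, k11, h11] at htr
      linear_combination htr / 2
    ext i j
    fin_cases i <;> fin_cases j <;>
      simp [Matrix.mul_apply, Fin.sum_univ_two, hα, ht, h11, k11, e0]
    ring
  have key := dvd_det_upper (M := Cm (AdSL h⁻¹).1 * M * Cm (AdSL h⁻¹⁻¹).1)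
    (M' := Cm (AdSL h⁻¹).1 * M' * Cm (AdSL h⁻¹⁻¹).1) rfl rfl ht h11 hε hq hα ?_
  · rwa [det_conj_Cm] at key
  · have e : ∀ X V, (Cm (AdSL h⁻¹).1 * X * Cm (AdSL h⁻¹⁻¹).1) * oneSub V =
        Cm (AdSL h⁻¹).1 * (X * oneSub (h * V * h⁻¹)) * Cm (AdSL h).1 := by
      intro X V
      rw [oneSub_conj, inv_inv]
      have : Cm (AdSL h⁻¹).1 * Cm (AdSL h).1 = 1 := by
        rw [← Cm_AdSL_mul, inv_mul_cancel, Cm_AdSL_one]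
      simp only [mul_assoc, this, mul_one]
    rw [e, e, hM]

end OneSub

/-! ### The Fox matrix -/

section FoxMatrix

open LaurentPolynomial

variable {k : ℕ} {n : ℤ}

theorem proj_r : proj k n (r k n) = 1 := PresentedGroup.one_of_mem rfl

theorem r_eq : r k n = w k ^ n * a * (w k ^ n)⁻¹ * b⁻¹ := by rw [r, zpow_neg]

/-- The defining relation `wⁿ a = b wⁿ`. -/
theorem proj_relation :
    proj k n (w k) ^ n * proj k n a = proj k n b * proj k n (w k) ^ n := by
  have h := (congrArg (proj k n) r_eq).symm.trans proj_r
  rw [map_mul, map_mul, map_mul, map_inv, map_inv, map_zpow, mul_inv_eq_one,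
    mul_inv_eq_iff_eq_mul] at h
  exact h

/-- The exponent of `t` attached to a word. -/
def expo (k : ℕ) (n : ℤ) (g : FreeGroup (Fin 2)) : ℤ := Multiplicative.toAdd (abel k n (proj k n g))

theorem expo_mul (g h : FreeGroup (Fin 2)) : expo k n (g * h) = expo k n g + expo k n h := by
  simp [expo]

theorem expo_inv (g : FreeGroup (Fin 2)) : expo k n g⁻¹ = -expo k n g := by
  simp [expo]

theorem expo_pow (g : FreeGroup (Fin 2)) (i : ℕ) : expo k n (g ^ i) = i * expo k n g := by
  simp [expo]

theorem expo_a : expo k n a = 1 := rfl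

theorem expo_b : expo k n b = 1 := rfl

variable (ρ : KnotGroup k n →* SL(2, ℂ))

/-- `Φ` on group elements, for the adjoint representation. -/
def tau : FreeGroup (Fin 2) →* Matrix (Fin 3) (Fin 3) ℂ[T;T⁻¹] :=
  (tensorRep (AdSL.comp ρ)).comp (proj k n)

theorem tau_eq (g : FreeGroup (Fin 2)) :
    tau ρ g = (T (expo k n g) : ℂ[T;T⁻¹]) • Cm (AdSL (ρ (proj k n g))).1 := rfl

theorem Phi_of (g : FreeGroup (Fin 2)) :
    Phi (AdSL.comp ρ) (MonoidAlgebra.of ℤ _ g) = tau ρ g := by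
  simp [Phi, tau]

theorem tau_of_proj_eq {g h : FreeGroup (Fin 2)} (e : proj k n g = proj k n h) :
    tau ρ g = tau ρ h := by
  change tensorRep _ _ = tensorRep _ _
  rw [e]

/-- The image under `Φ` of the Fox derivative. -/
def fox (x : Fin 2) (g : FreeGroup (Fin 2)) : Matrix (Fin 3) (Fin 3) ℂ[T;T⁻¹] :=
  Phi (AdSL.comp ρ) (foxDeriv x g)

theorem fox_mul (x : Fin 2) (g h : FreeGroup (Fin 2)) :
    fox ρ x (g * h) = fox ρ x g + tau ρ g * fox ρ x h := by
  rw [fox, foxDeriv_mul, map_add, map_mul, Phi_of]; rfl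

theorem fox_of (x y : Fin 2) : fox ρ x (FreeGroup.of y) = if y = x then 1 else 0 := by
  rw [fox, foxDeriv_of]
  split_ifs <;> simp

theorem fox_one (x : Fin 2) : fox ρ x 1 = 0 := by
  have h := fox_mul ρ x 1 1
  rw [map_one, one_mul, one_mul] at h
  simpa using h

theorem fox_inv (x : Fin 2) (g : FreeGroup (Fin 2)) :
    fox ρ x g⁻¹ = -(tau ρ g⁻¹ * fox ρ x g) := by
  have h := fox_mul ρ x g⁻¹ g
  rw [inv_mul_cancel, fox_one] at h
  exact eq_neg_of_add_eq_zero_left h.symm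

theorem fox_pow (x : Fin 2) (g : FreeGroup (Fin 2)) (m : ℕ) :
    fox ρ x (g ^ m) = (∑ i ∈ Finset.range m, tau ρ g ^ i) * fox ρ x g := by
  induction m with
  | zero => simp [fox_one]
  | succ m ih =>
    rw [pow_succ, fox_mul, ih, Finset.sum_range_succ, add_mul, map_pow]

/-- The fundamental formula of the Fox calculus. -/
theorem fox_fundamental (g : FreeGroup (Fin 2)) :
    fox ρ 0 g * (tau ρ a - 1) + fox ρ 1 g * (tau ρ b - 1) = tau ρ g - 1 := by
  have hmul : ∀ g h : FreeGroup (Fin 2),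
      fox ρ 0 g * (tau ρ a - 1) + fox ρ 1 g * (tau ρ b - 1) = tau ρ g - 1 →
      fox ρ 0 h * (tau ρ a - 1) + fox ρ 1 h * (tau ρ b - 1) = tau ρ h - 1 →
      fox ρ 0 (g * h) * (tau ρ a - 1) + fox ρ 1 (g * h) * (tau ρ b - 1) = tau ρ (g * h) - 1 := by
    intro g h hg hh
    rw [fox_mul, fox_mul, map_mul]
    calc _ = (fox ρ 0 g * (tau ρ a - 1) + fox ρ 1 g * (tau ρ b - 1)) +
          tau ρ g * (fox ρ 0 h * (tau ρ a - 1) + fox ρ 1 h * (tau ρ b - 1)) := by noncomm_ring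
      _ = _ := by rw [hg, hh]; noncomm_ring
  have hinv : ∀ g : FreeGroup (Fin 2),
      fox ρ 0 g * (tau ρ a - 1) + fox ρ 1 g * (tau ρ b - 1) = tau ρ g - 1 →
      fox ρ 0 g⁻¹ * (tau ρ a - 1) + fox ρ 1 g⁻¹ * (tau ρ b - 1) = tau ρ g⁻¹ - 1 := by
    intro g hg
    rw [fox_inv, fox_inv]
    calc _ = -(tau ρ g⁻¹ * (fox ρ 0 g * (tau ρ a - 1) + fox ρ 1 g * (tau ρ b - 1))) := by
          noncomm_ring
      _ = _ := by
          rw [hg, mul_sub, ← map_mul, inv_mul_cancel, map_one]; noncomm_ring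
  have hof : ∀ y : Fin 2, fox ρ 0 (FreeGroup.of y) * (tau ρ a - 1) +
      fox ρ 1 (FreeGroup.of y) * (tau ρ b - 1) = tau ρ (FreeGroup.of y) - 1 := by
    intro y
    fin_cases y <;> simp [fox_of, a, b]
  induction g using FreeGroup.induction_on with
  | C1 => simp [fox_one]
  | of y => exact hof y
  | inv_of y h => exact hinv _ h
  | mul g h hg hh => exact hmul g h hg hh

theorem one_sub_tau_a : 1 - tau ρ a = oneSub (ρ (proj k n a)) := rfl

theorem one_sub_tau_b : 1 - tau ρ b = oneSub (ρ (proj k n b)) := rfl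

theorem tau_r : tau ρ (r k n) = 1 := by
  change tensorRep _ _ = 1
  rw [proj_r, map_one]

theorem fox_r_mul :
    fox ρ 0 (r k n) * oneSub (ρ (proj k n a)) = -fox ρ 1 (r k n) * oneSub (ρ (proj k n b)) := by
  have h := fox_fundamental ρ (r k n)
  rw [tau_r, sub_self] at h
  rw [← one_sub_tau_a, ← one_sub_tau_b]
  have h2 := eq_neg_of_add_eq_zero_left h
  calc _ = -(fox ρ 0 (r k n) * (tau ρ a - 1)) := by noncomm_ring
    _ = _ := by rw [h2]; noncomm_ring

/-- The conjugate of a by wⁿ equals b in the knot group, so the derivatives of wⁿ and of w⁻ⁿ combine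
with the factor 1 − τ(b). -/
theorem fox_r : fox ρ 0 (r k n) =
    tau ρ (w k ^ n) + (1 - tau ρ b) * fox ρ 0 (w k ^ n) := by
  have hb : fox ρ 0 b = 0 := by simp [b, fox_of]
  have ha : fox ρ 0 a = 1 := by simp [a, fox_of]
  have hc : tau ρ (w k ^ n * a * (w k ^ n)⁻¹) = tau ρ b := by
    apply tau_of_proj_eq
    rw [map_mul, map_mul, map_inv, map_zpow, proj_relation, mul_inv_cancel_right]
  rw [r_eq, fox_mul, fox_inv ρ 0 b, hb, mul_zero, neg_zero, mul_zero, add_zero, fox_mul, fox_mul,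
    ha, mul_one, fox_inv, mul_neg, ← mul_assoc, ← map_mul, hc]
  noncomm_ring

/-- The Fox matrix of the relator, for `n = -N`. -/
theorem fox_r_neg (N : ℕ) (hN : n = -N) : fox ρ 0 (r k n) =
    tau ρ (w k)⁻¹ ^ N - (1 - tau ρ b) *
      ((∑ i ∈ Finset.range N, tau ρ (w k)⁻¹ ^ i) * tau ρ (w k)⁻¹ * fox ρ 0 (w k)) := by
  have e : w k ^ n = (w k)⁻¹ ^ N := by rw [hN, zpow_neg, zpow_natCast, inv_pow]
  rw [fox_r, e, fox_pow, map_pow, fox_inv]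
  noncomm_ring

/-! #### Extreme coefficients of the Fox matrix -/

theorem lead_tau (g : FreeGroup (Fin 2)) {ε : ℤ} (hε : ε * ε = 1) :
    Lead ε (ε * expo k n g) (tau ρ g) (AdSL (ρ (proj k n g))).1 := by
  rw [tau_eq]
  have h := (Lead.const ε (AdSL (ρ (proj k n g))).1).smul (ε * expo k n g)
  rwa [← mul_assoc, hε, one_mul, add_zero] at h

theorem lead_geom_tau (g : FreeGroup (Fin 2)) (hg : expo k n g = 0) (ε : ℤ) (m : ℕ) :
    Lead ε 0 (∑ i ∈ Finset.range m, tau ρ g ^ i)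
      (∑ i ∈ Finset.range m, (AdSL (ρ (proj k n g))).1 ^ i) := by
  have e : ∑ i ∈ Finset.range m, tau ρ g ^ i =
      Cm (∑ i ∈ Finset.range m, (AdSL (ρ (proj k n g))).1 ^ i) := by
    rw [map_sum]
    refine Finset.sum_congr rfl fun i _ => ?_
    rw [tau_eq, hg, T_zero, one_smul, map_pow]
  rw [e]
  exact Lead.const ε _

theorem lead_one_sub_tau_b : Lead 1 0 (1 - tau ρ b) 1 := by
  have h := lead_tau ρ b (ε := 1) rfl
  rw [expo_b] at h
  have h1 := (Lead.const 1 1).add (h.weaken (e' := 0) (by norm_num)).neg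
  simpa [sub_eq_add_neg] using h1

theorem lead_one_sub_tau_b' : Lead (-1) (-1) (1 - tau ρ b) (-(AdSL (ρ (proj k n b))).1) := by
  have h := lead_tau ρ b (ε := -1) rfl
  rw [expo_b, mul_one] at h
  have h1 := ((Lead.const (-1) 1).weaken (e' := -1) (by norm_num)).add h.neg
  rw [zero_add, ← sub_eq_add_neg, map_one] at h1
  exact h1

theorem det_AdSL (V : SL(2, ℂ)) : (AdSL V).1.det = 1 := (AdSL V).2

variable {ρ}

theorem w_even (m : ℕ) : w (2 * m) = (b * a⁻¹) ^ m * (b⁻¹ * a) ^ m := by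
  simp [w]

theorem w_odd (m : ℕ) : w (2 * m + 1) = (b * a⁻¹) ^ m * (b * a) * (b⁻¹ * a) ^ m := by
  have h : (2 * m + 1) / 2 = m := by omega
  simp [w, h]

theorem fox_x : fox ρ 0 (b * a⁻¹) = -tau ρ (b * a⁻¹) := by
  rw [fox_mul, fox_inv, map_mul]
  simp [fox_of, a, b]

theorem fox_z : fox ρ 0 (b⁻¹ * a) = tau ρ b⁻¹ := by
  rw [fox_mul, fox_inv]
  simp [fox_of, a, b]

theorem expo_x : expo k n (b * a⁻¹) = 0 := by simp [expo_mul, expo_inv, expo_a, expo_b]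

theorem expo_z : expo k n (b⁻¹ * a) = 0 := by simp [expo_mul, expo_inv, expo_a, expo_b]

theorem expo_w_even (m : ℕ) : expo k n (w (2 * m)) = 0 := by
  simp [w_even, expo_mul, expo_pow, expo_inv, expo_a, expo_b]

theorem expo_w_odd (m : ℕ) : expo k n (w (2 * m + 1)) = 2 := by
  simp [w_odd, expo_mul, expo_pow, expo_inv, expo_a, expo_b]

variable (ρ)

theorem fox_w_even (m : ℕ) : fox ρ 0 (w (2 * m)) =
    -((∑ i ∈ Finset.range m, tau ρ (b * a⁻¹) ^ i) * tau ρ (b * a⁻¹)) +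
      tau ρ ((b * a⁻¹) ^ m) * ((∑ i ∈ Finset.range m, tau ρ (b⁻¹ * a) ^ i) * tau ρ b⁻¹) := by
  rw [w_even, fox_mul, fox_pow, fox_pow, fox_x, fox_z, mul_neg]

/-- Here g (h⁻¹g)^i h⁻¹ = (gh⁻¹)^{i+1}, and the summand 1 supplies the missing zeroth power. For odd
`k` this merges the middle letter a with the right-hand power of b⁻¹a into a single sum of m + 1
terms. -/
theorem one_add_mul_geom_mul {G R : Type*} [Group G] [Ring R] (τ : G →* R) (g h : G) (m : ℕ) :
    1 + τ g * ((∑ i ∈ Finset.range m, τ (h⁻¹ * g) ^ i) * τ h⁻¹) =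
      ∑ i ∈ Finset.range (m + 1), τ (g * h⁻¹) ^ i := by
  rw [Finset.sum_range_succ', pow_zero, add_comm, Finset.sum_mul, Finset.mul_sum]
  congr 1
  refine Finset.sum_congr rfl fun i hi => ?_
  clear hi
  rw [← map_pow, ← map_pow, ← map_mul, ← map_mul]
  congr 1
  induction i with
  | zero => simp
  | succ i ih =>
    rw [pow_succ (g * h⁻¹), ← ih, pow_succ]
    group

theorem fox_w_odd (m : ℕ) : fox ρ 0 (w (2 * m + 1)) =
    -((∑ i ∈ Finset.range m, tau ρ (b * a⁻¹) ^ i) * tau ρ (b * a⁻¹)) +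
      tau ρ ((b * a⁻¹) ^ m) * (tau ρ b * ∑ i ∈ Finset.range (m + 1), tau ρ (a * b⁻¹) ^ i) := by
  have hb : fox ρ 0 (b * a) = tau ρ b := by
    rw [fox_mul]; simp [fox_of, a, b]
  rw [w_odd, fox_mul, fox_mul, fox_pow, fox_pow, fox_x, fox_z, hb, ← one_add_mul_geom_mul, mul_neg,
    map_mul (tau ρ) _ (b * a), map_mul (tau ρ) b a, mul_add, mul_one, mul_add, add_assoc]
  simp only [mul_assoc]

end FoxMatrix

/-! ### Extreme terms of the Fox matrix and of the quotient. -/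

section Extreme

open LaurentPolynomial

variable {k : ℕ} {n : ℤ}

theorem one_sub_T_pow_ne_zero : (1 - T 1 : ℂ[T;T⁻¹]) ^ 3 ≠ 0 := by
  refine pow_ne_zero _ fun h => ?_
  have := congrArg (fun f : ℂ[T;T⁻¹] => f.coeff 0) h
  simp [← LaurentPolynomial.T_zero] at this

/-- Extreme terms of the twisted Alexander polynomial from those of the Fox matrix. -/
theorem hasExtremeTerms_of_lead (ρ : KnotGroup k n →* SL(2, ℂ))
    (h2 : (ρ (proj k n b)).1.trace = 2 ∨ (ρ (proj k n b)).1.trace = -2)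
    (hab : (ρ (proj k n a)).1.trace = (ρ (proj k n b)).1.trace)
    (hne : ρ (proj k n a) * ρ (proj k n b) ≠ ρ (proj k n b) * ρ (proj k n a))
    {e f : ℤ} {E F : Matrix (Fin 3) (Fin 3) ℂ}
    (hE : Lead 1 e (fox ρ 0 (r k n)) E) (hF : Lead (-1) f (fox ρ 0 (r k n)) F)
    (hE0 : E.det ≠ 0) (hF0 : F.det ≠ 0) :
    HasExtremeTerms (adjointTwistedAlexander ρ) (-F.det) (-(3 * f) - 3) E.det (3 * e) := by
  obtain ⟨P, hP⟩ := dvd_det hab h2 hne (fox_r_mul ρ)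
  obtain ⟨e1, e2⟩ := hE.coeff_det (by norm_num)
  obtain ⟨f1, f2⟩ := hF.coeff_det (by norm_num)
  rw [mul_comm] at hP
  rw [hP] at e1 e2 f1 f2
  rw [one_mul] at e1
  simp only [one_mul] at e2
  obtain ⟨a1, a2, a3, a4⟩ := extreme_of_mul_one_sub_T_pow_three (hi := -(3 * f) - 3) (c := F.det) e2
    (fun i hi => f2 i (by omega)) (by rw [← f1]; congr 1; ring) e1
  refine ⟨P, ?_, neg_ne_zero.2 hF0, hE0, a3, a4, fun i hi => ⟨?_, ?_⟩⟩
  · have hb : (Phi (AdSL.comp ρ) (1 - MonoidAlgebra.of ℤ _ b)).det = (1 - T 1) ^ 3 := by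
      rw [map_sub, map_one, Phi_of, one_sub_tau_b, det_oneSub h2]
    rw [adjointTwistedAlexander, twistedAlexander, hb, eq_div_iff]
    · rw [← map_mul]
      exact congrArg _ hP.symm
    · rw [Ne, FaithfulSMul.algebraMap_eq_zero_iff]
      exact one_sub_T_pow_ne_zero
  · by_contra h
    exact hi (a1 i (by omega))
  · by_contra h
    exact hi (a2 i (by omega))

theorem lead_tau_of_expo {ρ : KnotGroup k n →* SL(2, ℂ)} {g : FreeGroup (Fin 2)} {c : ℤ}
    (hg : expo k n g = c) {ε : ℤ} (hε : ε * ε = 1) {e : ℤ} (he : ε * c = e) :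
    Lead ε e (tau ρ g) (AdSL (ρ (proj k n g))).1 := by
  rw [← he, ← hg]
  exact lead_tau ρ g hε

theorem det_geom_tau (ρ : KnotGroup k n →* SL(2, ℂ)) (g : FreeGroup (Fin 2)) (m : ℕ) :
    (∑ i ∈ Finset.range m, (AdSL (ρ (proj k n g))).1 ^ i).det =
      m * S ((m : ℤ) - 1) (ρ (proj k n g)).1.trace ^ 2 := det_geom _ _

theorem trace_proj_inv (ρ : KnotGroup k n →* SL(2, ℂ)) (g : FreeGroup (Fin 2)) :
    (ρ (proj k n g⁻¹)).1.trace = (ρ (proj k n g)).1.trace := by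
  rw [map_inv, map_inv, trace_inv]

theorem trace_proj_x (ρ : KnotGroup k n →* SL(2, ℂ)) :
    (ρ (proj k n (b * a⁻¹))).1.trace = yTrace ρ := by
  rw [yTrace, ← trace_proj_inv]
  simp

theorem trace_proj_z (ρ : KnotGroup k n →* SL(2, ℂ)) :
    (ρ (proj k n (b⁻¹ * a))).1.trace = yTrace ρ := by
  have e : b⁻¹ * a = b⁻¹ * (a * b⁻¹) * b⁻¹⁻¹ := by group
  rw [e, map_mul, map_mul, map_inv _ b⁻¹, map_mul, map_mul, map_inv _ (proj k n b⁻¹), trace_conj,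
    yTrace]

variable (ρ : KnotGroup k n →* SL(2, ℂ))

theorem Lead.cast {ε e e' : ℤ} {M : Matrix (Fin 3) (Fin 3) ℂ[T;T⁻¹]}
    {E : Matrix (Fin 3) (Fin 3) ℂ} (h : Lead ε e M E) (he : e = e') : Lead ε e' M E := he ▸ h

section Assembly

variable {W B X P B' Ω Xs Zs : Matrix (Fin 3) (Fin 3) ℂ[T;T⁻¹]}
  {W₀ B₀ X₀ P₀ B₀' Ω₀ Xs₀ Zs₀ : Matrix (Fin 3) (Fin 3) ℂ}

/-- For even `k` the only factor of negative degree is τ(b⁻¹), which occurs in the second half of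
∂w/∂a. In the companion `Lead.even_high` the only factor of positive degree is −τ(b) from 1 − τ(b),
and it picks out the first half. -/
theorem Lead.even_low (hW : Lead 1 0 W W₀) (hB : Lead 1 0 (1 - B) 1) (hΩ : Lead 1 0 Ω Ω₀)
    (hX : Lead 1 0 X X₀) (hXs : Lead 1 0 Xs Xs₀) (hZs : Lead 1 0 Zs Zs₀) (hP : Lead 1 0 P P₀)
    (hB' : Lead 1 (-1) B' B₀') (N : ℕ) :
    Lead 1 (-1) (W ^ N - (1 - B) * (Ω * W * (-(Xs * X) + P * (Zs * B'))))
      (-(Ω₀ * W₀ * (P₀ * (Zs₀ * B₀')))) := by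
  have hD := ((hXs.mul hX).neg.weaken (e' := -1) (by norm_num)).add
    ((hP.mul (hZs.mul hB')).cast (e' := -1) (by norm_num))
  have hM := ((hW.pow N).weaken (e' := -1) (by norm_num)).add
    ((hB.mul ((hΩ.mul hW).mul hD)).neg.cast (e' := -1) (by norm_num))
  rwa [zero_add, zero_add, one_mul, ← sub_eq_add_neg] at hM

theorem Lead.even_high (hW : Lead (-1) 0 W W₀) (hB : Lead (-1) (-1) (1 - B) (-B₀))
    (hΩ : Lead (-1) 0 Ω Ω₀) (hX : Lead (-1) 0 X X₀) (hXs : Lead (-1) 0 Xs Xs₀)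
    (hZs : Lead (-1) 0 Zs Zs₀) (hP : Lead (-1) 0 P P₀) (hB' : Lead (-1) 1 B' B₀') (N : ℕ) :
    Lead (-1) (-1) (W ^ N - (1 - B) * (Ω * W * (-(Xs * X) + P * (Zs * B'))))
      (-(B₀ * (Ω₀ * W₀ * (Xs₀ * X₀)))) := by
  have hD := ((hXs.mul hX).neg.cast (e' := 0) (by norm_num)).add
    ((hP.mul (hZs.mul hB')).weaken (e' := 0) (by norm_num))
  have hM := ((hW.pow N).weaken (e' := -1) (by norm_num)).add
    ((hB.mul ((hΩ.mul hW).mul hD)).neg.cast (e' := -1) (by norm_num))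
  rw [zero_add, add_zero, ← sub_eq_add_neg] at hM
  convert! hM using 1
  noncomm_ring

/-- The pure power of W and the term with Xs · X have the same order, since the geometric sum in W
is dominated by its last term; the two add up to the factor Xs₀ X₀ + 1. At the opposite end, in
`Lead.odd_high`, the sum in W is dominated by 1, and the two factors of degree 1 compensate the
degree −2 of W. -/
theorem Lead.odd_low {N : ℕ} (hW : Lead 1 (-2) W W₀) (hB : Lead 1 0 (1 - B) 1)
    (hΩ : Lead 1 (N * -2) Ω (W₀ ^ N))
    (hX : Lead 1 0 X X₀) (hXs : Lead 1 0 Xs Xs₀) (hZs : Lead 1 0 Zs Zs₀) (hP : Lead 1 0 P P₀)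
    (hB' : Lead 1 1 B' B₀') :
    Lead 1 (-(2 * (N + 1 : ℕ))) (W ^ (N + 1) - (1 - B) * (Ω * W * (-(Xs * X) + P * (B' * Zs))))
      (W₀ ^ (N + 1) * (Xs₀ * X₀ + 1)) := by
  have hD := ((hXs.mul hX).neg.cast (e' := 0) (by norm_num)).add
    ((hP.mul (hB'.mul hZs)).weaken (e' := 0) (by norm_num))
  have hM := ((hW.pow (N + 1)).cast (e' := -(2 * (N + 1 : ℕ))) (by ring)).add
    ((hB.mul ((hΩ.mul hW).mul hD)).neg.cast (e' := -(2 * (N + 1 : ℕ))) (by push_cast; ring))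
  rw [add_zero, ← sub_eq_add_neg, ← pow_succ, one_mul] at hM
  convert! hM using 1
  noncomm_ring

theorem Lead.odd_high {N : ℕ} (hW : Lead (-1) 2 W W₀) (hB : Lead (-1) (-1) (1 - B) (-B₀))
    (hΩ : Lead (-1) 0 Ω 1)
    (hX : Lead (-1) 0 X X₀) (hXs : Lead (-1) 0 Xs Xs₀) (hZs : Lead (-1) 0 Zs Zs₀)
    (hP : Lead (-1) 0 P P₀) (hB' : Lead (-1) (-1) B' B₀') :
    Lead (-1) 0 (W ^ (N + 1) - (1 - B) * (Ω * W * (-(Xs * X) + P * (B' * Zs))))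
      (B₀ * (W₀ * (P₀ * (B₀' * Zs₀)))) := by
  have hD := ((hXs.mul hX).neg.weaken (e' := -1) (by norm_num)).add
    ((hP.mul (hB'.mul hZs)).cast (e' := -1) (by norm_num))
  have hM := ((hW.pow (N + 1)).weaken (e' := 0) (by positivity)).add
    ((hB.mul ((hΩ.mul hW).mul hD)).neg.cast (e' := 0) (by norm_num))
  rw [zero_add, zero_add, one_mul, ← sub_eq_add_neg, neg_mul, neg_neg] at hM
  exact hM

end Assembly

theorem lead_tau_x {ε : ℤ} (hε : ε * ε = 1) : Lead ε 0 (tau ρ (b * a⁻¹))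
    (AdSL (ρ (proj k n (b * a⁻¹)))).1 :=
  lead_tau_of_expo expo_x hε (mul_zero _)

theorem lead_tau_x_pow {ε : ℤ} (hε : ε * ε = 1) (m : ℕ) : Lead ε 0 (tau ρ ((b * a⁻¹) ^ m))
    (AdSL (ρ (proj k n ((b * a⁻¹) ^ m)))).1 :=
  lead_tau_of_expo (c := 0) (by rw [expo_pow, expo_x, mul_zero]) hε (mul_zero _)

theorem expo_y : expo k n (a * b⁻¹) = 0 := by simp [expo_mul, expo_inv, expo_a, expo_b]

theorem lead_low_even (m N : ℕ) (hk : k = 2 * m) (hn : n = -N) :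
    ∃ E : Matrix (Fin 3) (Fin 3) ℂ, Lead 1 (-1) (fox ρ 0 (r k n)) E ∧
      E.det = -((m : ℂ) * N * S ((m : ℤ) - 1) (yTrace ρ) ^ 2 *
        S ((N : ℤ) - 1) (zTrace ρ) ^ 2) := by
  subst hk
  have hw' : expo (2 * m) n (w (2 * m))⁻¹ = 0 := by rw [expo_inv, expo_w_even, neg_zero]
  have hW := lead_tau_of_expo (ρ := ρ) hw' (ε := 1) (by norm_num) (mul_zero _)
  have hb' : expo (2 * m) n b⁻¹ = -1 := by rw [expo_inv, expo_b]
  have hB' := lead_tau_of_expo (ρ := ρ) hb' (ε := 1) (by norm_num) (one_mul _)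
  have hM := hW.even_low (lead_one_sub_tau_b ρ) (lead_geom_tau ρ _ hw' 1 N)
    (lead_tau_x ρ (by norm_num)) (lead_geom_tau ρ _ expo_x 1 m) (lead_geom_tau ρ _ expo_z 1 m)
    (lead_tau_x_pow ρ (by norm_num) m) hB' N
  rw [← fox_w_even, ← fox_r_neg ρ N hn] at hM
  refine ⟨_, hM, ?_⟩
  rw [Matrix.det_neg, Matrix.det_mul, Matrix.det_mul, Matrix.det_mul, Matrix.det_mul,
    det_geom_tau, det_geom_tau, det_AdSL, det_AdSL, det_AdSL,
    trace_proj_inv, trace_proj_z, zTrace, Fintype.card_fin]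
  ring

theorem lead_high_even (m N : ℕ) (hk : k = 2 * m) (hn : n = -N) :
    ∃ F : Matrix (Fin 3) (Fin 3) ℂ, Lead (-1) (-1) (fox ρ 0 (r k n)) F ∧
      F.det = -((m : ℂ) * N * S ((m : ℤ) - 1) (yTrace ρ) ^ 2 *
        S ((N : ℤ) - 1) (zTrace ρ) ^ 2) := by
  subst hk
  have hw' : expo (2 * m) n (w (2 * m))⁻¹ = 0 := by rw [expo_inv, expo_w_even, neg_zero]
  have hW := lead_tau_of_expo (ρ := ρ) hw' (ε := -1) (by norm_num) (mul_zero _)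
  have hb' : expo (2 * m) n b⁻¹ = -1 := by rw [expo_inv, expo_b]
  have hB' := lead_tau_of_expo (ρ := ρ) hb' (ε := -1) (by norm_num) (e := 1) (by norm_num)
  have hM := hW.even_high (lead_one_sub_tau_b' ρ) (lead_geom_tau ρ _ hw' (-1) N)
    (lead_tau_x ρ (by norm_num)) (lead_geom_tau ρ _ expo_x (-1) m)
    (lead_geom_tau ρ _ expo_z (-1) m) (lead_tau_x_pow ρ (by norm_num) m) hB' N
  rw [← fox_w_even, ← fox_r_neg ρ N hn] at hM
  refine ⟨_, hM, ?_⟩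
  rw [Matrix.det_neg, Matrix.det_mul, Matrix.det_mul, Matrix.det_mul, Matrix.det_mul,
    det_geom_tau, det_geom_tau, det_AdSL, det_AdSL, det_AdSL,
    trace_proj_inv, trace_proj_x, zTrace, Fintype.card_fin]
  ring

theorem lead_low_odd (m N : ℕ) (hk : k = 2 * m + 1) (hn : n = -(N + 1 : ℕ)) :
    ∃ E : Matrix (Fin 3) (Fin 3) ℂ, Lead 1 (-(2 * (N + 1 : ℕ))) (fox ρ 0 (r k n)) E ∧
      E.det = ((m : ℂ) + 1) * S m (yTrace ρ) ^ 2 := by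
  subst hk
  have hw' : expo (2 * m + 1) n (w (2 * m + 1))⁻¹ = -2 := by rw [expo_inv, expo_w_odd]
  have hW := lead_tau_of_expo (ρ := ρ) hw' (ε := 1) (by norm_num) (one_mul _)
  have hB := lead_tau_of_expo (ρ := ρ) expo_b (ε := 1) (by norm_num) (one_mul _)
  have hM := hW.odd_low (lead_one_sub_tau_b ρ) (hW.geom_neg (by norm_num) N)
    (lead_tau_x ρ (by norm_num)) (lead_geom_tau ρ _ expo_x 1 m)
    (lead_geom_tau ρ _ expo_y 1 (m + 1)) (lead_tau_x_pow ρ (by norm_num) m) hB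
  rw [← fox_w_odd, ← fox_r_neg ρ (N + 1) hn] at hM
  refine ⟨_, hM, ?_⟩
  -- The factor (Σ_{i<m} X^i) X + 1 is the geometric sum with m + 1 terms.
  rw [Finset.sum_mul]
  simp only [← pow_succ]
  rw [← pow_zero (AdSL (ρ ((proj (2 * m + 1) n) (b * a⁻¹)))).1, ← Finset.sum_range_succ',
    Matrix.det_mul, Matrix.det_pow, det_AdSL, det_geom_tau, trace_proj_x]
  push_cast
  rw [add_sub_cancel_right]
  ring

theorem lead_high_odd (m N : ℕ) (hk : k = 2 * m + 1) (hn : n = -(N + 1 : ℕ)) :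
    ∃ F : Matrix (Fin 3) (Fin 3) ℂ, Lead (-1) 0 (fox ρ 0 (r k n)) F ∧
      F.det = ((m : ℂ) + 1) * S m (yTrace ρ) ^ 2 := by
  subst hk
  have hw' : expo (2 * m + 1) n (w (2 * m + 1))⁻¹ = -2 := by rw [expo_inv, expo_w_odd]
  have hW := lead_tau_of_expo (ρ := ρ) hw' (ε := -1) (by norm_num) (e := 2) (by norm_num)
  have hB := lead_tau_of_expo (ρ := ρ) expo_b (ε := -1) (by norm_num) (e := -1) (by norm_num)
  have hM := hW.odd_high (N := N) (lead_one_sub_tau_b' ρ) (hW.geom_pos (by norm_num) N)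
    (lead_tau_x ρ (by norm_num)) (lead_geom_tau ρ _ expo_x (-1) m)
    (lead_geom_tau ρ _ expo_y (-1) (m + 1)) (lead_tau_x_pow ρ (by norm_num) m) hB
  rw [← fox_w_odd, ← fox_r_neg ρ (N + 1) hn] at hM
  refine ⟨_, hM, ?_⟩
  rw [Matrix.det_mul, Matrix.det_mul, Matrix.det_mul, Matrix.det_mul, det_geom_tau, det_AdSL,
    det_AdSL, det_AdSL, yTrace]
  push_cast
  rw [add_sub_cancel_right]
  ring

end Extreme

/-! ### Non-vanishing for parabolic representations -/

section Nonvanishing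

variable {k : ℕ} {n : ℤ}

theorem coe_mul_self {R : Type*} [CommRing R] (g : Matrix.SpecialLinearGroup (Fin 2) R) :
    g.1 * g.1 = g.1.trace • g.1 - 1 := by
  have hd : g.1 0 0 * g.1 1 1 - g.1 0 1 * g.1 1 0 = 1 := by
    rw [← Matrix.det_fin_two]; exact g.2
  ext i j
  fin_cases i <;> fin_cases j <;> simp [Matrix.mul_apply, Fin.sum_univ_two, Matrix.trace_fin_two]
  · linear_combination -hd
  · ring
  · ring
  · linear_combination -hd

/-- Powers of a matrix in `SL₂` through Chebyshev polynomials. -/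
theorem pow_eq_chebyshev {R : Type*} [CommRing R] (g : Matrix.SpecialLinearGroup (Fin 2) R)
    (m : ℕ) : (g ^ m).1 = (Polynomial.Chebyshev.S R ((m : ℤ) - 1)).eval g.1.trace • g.1 -
      (Polynomial.Chebyshev.S R ((m : ℤ) - 2)).eval g.1.trace • (1 : Matrix (Fin 2) (Fin 2) R) := by
  induction m with
  | zero => simp
  | succ m ih =>
    have h1 : ((m + 1 : ℕ) : ℤ) - 1 = m := by push_cast; ring
    have h2 : ((m + 1 : ℕ) : ℤ) - 2 = m - 1 := by push_cast; ring
    rw [pow_succ, Matrix.SpecialLinearGroup.coe_mul, ih, h1, h2, Polynomial.Chebyshev.S_eq R m,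
      sub_mul, smul_mul_assoc, coe_mul_self, smul_mul_assoc, one_mul, Polynomial.eval_sub,
      Polynomial.eval_mul, Polynomial.eval_X]
    module

theorem pow_eq_of_S_eq_zero {g : SL(2, ℂ)} {m : ℕ} (h : S ((m : ℤ) - 1) g.1.trace = 0) :
    (g ^ m).1 = -S ((m : ℤ) - 2) g.1.trace • (1 : Matrix (Fin 2) (Fin 2) ℂ) := by
  have h1 := pow_eq_chebyshev g m
  rw [S] at h
  rw [h, zero_smul, zero_sub, ← neg_smul] at h1
  exact h1

/-- If `S_{m-1}(tr g) = 0` then `gᵐ` is a central involution depending only on `tr g`. -/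
theorem exists_central_of_S_eq_zero {m : ℕ} {y : ℂ} (h : S ((m : ℤ) - 1) y = 0) :
    ∃ c : SL(2, ℂ), c * c = 1 ∧ (∀ x, c * x = x * c) ∧
      ∀ g : SL(2, ℂ), g.1.trace = y → g ^ m = c := by
  have hsq : S ((m : ℤ) - 2) y * S ((m : ℤ) - 2) y = 1 := by
    have := congrArg (Polynomial.eval y) (Polynomial.Chebyshev.S_sq_add_S_sq ℂ ((m : ℤ) - 2))
    rw [show (m : ℤ) - 2 + 1 = m - 1 by ring] at this
    simp only [Polynomial.eval_sub, Polynomial.eval_add, Polynomial.eval_pow, Polynomial.eval_mul,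
      Polynomial.eval_X, Polynomial.eval_one] at this
    change S _ y ^ 2 + S _ y ^ 2 - y * S _ y * S _ y = 1 at this
    rw [h] at this
    linear_combination this
  let c : SL(2, ℂ) := ⟨-S ((m : ℤ) - 2) y • 1, by
    rw [Matrix.det_smul, Matrix.det_one, Fintype.card_fin]; linear_combination hsq⟩
  have hc : c.1 = -S ((m : ℤ) - 2) y • 1 := rfl
  refine ⟨c, ?_, ?_, ?_⟩
  · apply Subtype.ext
    rw [Matrix.SpecialLinearGroup.coe_mul, hc, smul_mul_smul_comm, neg_mul_neg, hsq]
    simp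
  · intro x
    apply Subtype.ext
    rw [Matrix.SpecialLinearGroup.coe_mul, Matrix.SpecialLinearGroup.coe_mul, hc]
    simp
  · rintro g rfl
    exact Subtype.ext (pow_eq_of_S_eq_zero h)

theorem commute_of_commute_a_b {H : Type*} [Group H] (f : KnotGroup k n →* H)
    (hc : f (proj k n a) * f (proj k n b) = f (proj k n b) * f (proj k n a)) (g h : KnotGroup k n) :
    f g * f h = f h * f g := by
  have key : ∀ x, f (proj k n a) * x = x * f (proj k n a) →
      f (proj k n b) * x = x * f (proj k n b) →
      ∀ g, f g * x = x * f g := by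
    intro x ha hb g
    have := PresentedGroup.generated_by ({r k n} : Set (FreeGroup (Fin 2)))
      ((Subgroup.centralizer {x}).comap f) (fun j => by
        rw [Subgroup.mem_comap, Subgroup.mem_centralizer_singleton_iff]
        fin_cases j
        · exact ha
        · exact hb) g
    rw [Subgroup.mem_comap, Subgroup.mem_centralizer_singleton_iff] at this
    exact this
  refine key _ ?_ ?_ g
  · exact (key _ rfl hc.symm h).symm
  · exact (key _ hc rfl h).symm

theorem trace_a_eq_trace_b (ρ : KnotGroup k n →* SL(2, ℂ)) :
    (ρ (proj k n a)).1.trace = (ρ (proj k n b)).1.trace := by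
  have h := congrArg ρ (eq_mul_inv_of_mul_eq (proj_relation (k := k) (n := n)).symm)
  rw [map_mul, map_mul, map_inv] at h
  rw [h, trace_conj]

/-- At a zero, (ba⁻¹)^m and (b⁻¹a)^m map to the same central involution because their bases have the
same trace. Then w maps to 1 and the relation reads ρ(a) = ρ(b). -/
theorem S_ne_zero_even_y (ρ : KnotGroup k n →* SL(2, ℂ)) {m : ℕ} (hk : k = 2 * m)
    (hne : ρ (proj k n a) ≠ ρ (proj k n b)) : S ((m : ℤ) - 1) (yTrace ρ) ≠ 0 := by
  subst hk
  intro h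
  obtain ⟨c, hc, -, hg⟩ := exists_central_of_S_eq_zero h
  have hw : ρ (proj (2 * m) n (w (2 * m))) = 1 := by
    rw [w_even, map_mul, map_mul, map_pow, map_pow, map_pow, map_pow, hg _ (trace_proj_x ρ),
      hg _ (trace_proj_z ρ), hc]
  have hr := congrArg ρ (proj_relation (k := 2 * m) (n := n))
  rw [map_mul, map_mul, map_zpow, hw, one_zpow, one_mul, mul_one] at hr
  exact hne hr

/-- At a zero, wⁿ maps to a central element, which cancels from wⁿa = bwⁿ. -/
theorem S_ne_zero_z (ρ : KnotGroup k n →* SL(2, ℂ)) {N : ℕ} (hn : n = -N)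
    (hne : ρ (proj k n a) ≠ ρ (proj k n b)) : S ((N : ℤ) - 1) (zTrace ρ) ≠ 0 := by
  subst hn
  intro h
  obtain ⟨c, hc, hcomm, hg⟩ := exists_central_of_S_eq_zero h
  have hr := congrArg ρ (proj_relation (k := k) (n := -N))
  have e : (ρ (proj k (-N) (w k))) ^ (-N : ℤ) = c := by
    rw [zpow_neg, zpow_natCast, hg _ rfl]
    exact inv_eq_of_mul_eq_one_left hc
  rw [map_mul, map_mul, map_zpow, e, hcomm] at hr
  exact hne (mul_right_cancel hr)

/-- A root has the form s + s⁻¹ with s^{2(m+1)} = 1, so it equals 2 Re s with |s| = 1. -/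
theorem exists_re_of_S_eq_zero {m : ℕ} {y : ℂ} (h : S m y = 0) :
    ∃ x : ℝ, y = x ∧ x ≤ 2 := by
  obtain ⟨s, hs, rfl⟩ := exists_add_inv_eq y
  have h1 := sum_sq_pow s hs (m + 1)
  have h2 : (((m + 1 : ℕ) : ℤ) - 1) = m := by push_cast; ring
  rw [h2, h, mul_zero] at h1
  have h3 := mul_geom_sum (s ^ 2) (m + 1)
  rw [(mul_eq_zero.1 h1).resolve_left hs, mul_zero] at h3
  have h4 : ‖s‖ = 1 := by
    have h5 : s ^ (2 * (m + 1)) = 1 := by rw [pow_mul]; exact (sub_eq_zero.1 h3.symm)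
    have h6 := congrArg norm h5
    rw [norm_pow, norm_one] at h6
    exact (pow_eq_one_iff_of_nonneg (norm_nonneg _) (by omega)).1 h6
  refine ⟨2 * s.re, ?_, ?_⟩
  · rw [Complex.inv_eq_conj h4, Complex.add_conj]
  · have := Complex.re_le_norm s
    linarith

theorem S_real_mono {x : ℝ} (hx : 2 ≤ x) (j : ℕ) :
    ∃ p q : ℝ, S ((j : ℤ) - 1) x = p ∧ S j x = q ∧ 0 ≤ p ∧ p + 1 ≤ q := by
  induction j with
  | zero => exact ⟨0, 1, by simp [S], by simp [S], le_rfl, by norm_num⟩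
  | succ j ih =>
    obtain ⟨p, q, hp, hq, h0, h1⟩ := ih
    refine ⟨q, x * q - p, ?_, ?_, by linarith, by nlinarith⟩
    · rw [← hq]; congr 1; push_cast; ring
    · have : S ((j + 1 : ℕ) : ℤ) x = x * S j x - S ((j : ℤ) - 1) x := by
        simp [S, Polynomial.Chebyshev.S_add_one]
      rw [this, hp, hq]; push_cast; ring

/-- The torus relation `α (αβ)ᴺ = (αβ)ᴺ β` forces a Chebyshev identity. -/
theorem chebyshev_of_torus_relation {α β : SL(2, ℂ)} (htr : α.1.trace = β.1.trace) (hne : α ≠ β)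
    {N : ℕ} (h : α * (α * β) ^ N = (α * β) ^ N * β) :
    S ((N : ℤ) - 1) (α * β).1.trace = S ((N : ℤ) - 2) (α * β).1.trace := by
  have hc := pow_eq_chebyshev (α * β) N
  have h' := congrArg Subtype.val h
  rw [Matrix.SpecialLinearGroup.coe_mul α, Matrix.SpecialLinearGroup.coe_mul _ β, hc] at h'
  change α.1 * (S _ _ • (α * β).1 - S _ _ • 1) = (S _ _ • (α * β).1 - S _ _ • 1) * β.1 at h'
  generalize S ((N : ℤ) - 1) (α * β).1.trace = p at *
  generalize S ((N : ℤ) - 2) (α * β).1.trace = q at *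
  rw [Matrix.SpecialLinearGroup.coe_mul] at h'
  have hA := coe_mul_self α
  have hB := coe_mul_self β
  rw [htr] at hA
  generalize β.1.trace = τ at *
  by_contra hpq
  apply hne
  apply Subtype.ext
  -- By Cayley–Hamilton with common trace τ, the difference α(pαβ − q) − (pαβ − q)β simplifies to (p
  -- − q)(α − β).
  have key : (p - q) • (α.1 - β.1) = 0 := by
    calc (p - q) • (α.1 - β.1) = p • ((τ • α.1 - 1) * β.1) - q • α.1 -
          (p • (α.1 * (τ • β.1 - 1)) - q • β.1) := by
            rw [sub_mul, mul_sub, smul_mul_assoc, mul_smul_comm, one_mul, mul_one]; module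
      _ = α.1 * (p • (α.1 * β.1) - q • 1) - (p • (α.1 * β.1) - q • 1) * β.1 := by
            rw [← hA, ← hB]
            simp only [mul_sub, sub_mul, mul_smul_comm, smul_mul_assoc, mul_one, one_mul, mul_assoc]
      _ = 0 := sub_eq_zero.2 h'
  exact sub_eq_zero.1 ((smul_eq_zero.1 key).resolve_left (sub_ne_zero.2 hpq))

theorem trace_mul_add_trace_mul_inv (α β : SL(2, ℂ)) :
    (α * β).1.trace + (α * β⁻¹).1.trace = α.1.trace * β.1.trace := by
  rw [Matrix.SpecialLinearGroup.coe_mul, Matrix.SpecialLinearGroup.coe_mul,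
    Matrix.SpecialLinearGroup.coe_inv, Matrix.adjugate_fin_two]
  simp [Matrix.trace_fin_two, Matrix.mul_apply, Fin.sum_univ_two]
  ring

/-- At a zero, the (m + 1)-st powers of ba⁻¹ and b⁻¹a map to the same central involution, which
makes w map to αβ. The relation becomes that of a torus knot and forces S_N = S_{N−1} at tr(αβ).
Since the meridian traces are ±2, tr(αβ) = 4 − y, which is real and at least 2 because y is a root
of S_m; there S_N ≥ S_{N−1} + 1. -/
theorem S_ne_zero_odd_y (ρ : KnotGroup k n →* SL(2, ℂ)) {m N : ℕ} (hk : k = 2 * m + 1)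
    (hn : n = -(N + 1 : ℕ))
    (htr : (ρ (proj k n a)).1.trace = 2 ∨ (ρ (proj k n a)).1.trace = -2)
    (hne : ρ (proj k n a) ≠ ρ (proj k n b)) : S m (yTrace ρ) ≠ 0 := by
  subst hk hn
  intro h
  have h' : S (((m + 1 : ℕ) : ℤ) - 1) (yTrace ρ) = 0 := by rw [← h]; congr 1; push_cast; ring
  obtain ⟨c, hc, hcomm, hg⟩ := exists_central_of_S_eq_zero h'
  have hx := hg _ (trace_proj_x ρ)
  have hz := hg _ (trace_proj_z ρ)
  have hr := congrArg ρ (proj_relation (k := 2 * m + 1) (n := -(N + 1 : ℕ)))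
  have hab := trace_a_eq_trace_b ρ
  have hy : (ρ (proj (2 * m + 1) (-(N + 1 : ℕ)) a) * (ρ (proj (2 * m + 1) (-(N + 1 : ℕ)) b))⁻¹).1.trace =
      yTrace ρ := by rw [yTrace, map_mul, map_mul, map_inv, map_inv]
  have hw : ρ (proj (2 * m + 1) (-(N + 1 : ℕ)) (w (2 * m + 1))) =
      (ρ (proj (2 * m + 1) (-(N + 1 : ℕ)) (b * a⁻¹))) ^ m * (ρ (proj (2 * m + 1) (-(N + 1 : ℕ)) (b * a))) *
      (ρ (proj (2 * m + 1) (-(N + 1 : ℕ)) (b⁻¹ * a))) ^ m := by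
    rw [w_odd]; simp only [map_mul, map_pow]
  rw [map_mul, map_mul, map_zpow, hw] at hr
  simp only [map_mul, map_inv] at hx hz hr
  generalize ρ (proj (2 * m + 1) (-(N + 1 : ℕ)) a) = α at *
  generalize ρ (proj (2 * m + 1) (-(N + 1 : ℕ)) b) = β at *
  have e : (β * α⁻¹) ^ m * (β * α) * (β⁻¹ * α) ^ m = α * β := by
    have hx' : (β * α⁻¹) ^ m = c * (β * α⁻¹)⁻¹ := by
      rw [← hx, pow_succ, mul_inv_cancel_right]
    have hz' : (β⁻¹ * α) ^ m = (β⁻¹ * α)⁻¹ * c := by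
      rw [← hz, pow_succ', inv_mul_cancel_left]
    rw [hx', hz']
    calc _ = c * (α * β * c) := by group
      _ = _ := by rw [← hcomm (α * β), ← mul_assoc, hc, one_mul]
  rw [e, zpow_neg, zpow_natCast] at hr
  have hr' : α * (α * β) ^ (N + 1) = (α * β) ^ (N + 1) * β := by
    calc α * (α * β) ^ (N + 1) = (α * β) ^ (N + 1) * (((α * β) ^ (N + 1))⁻¹ * α) * (α * β) ^ (N + 1) := by group
      _ = _ := by rw [hr]; group
  have hS := chebyshev_of_torus_relation hab hne hr'
  obtain ⟨x, hx, hx2⟩ := exists_re_of_S_eq_zero h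
  have ht : (α * β).1.trace = ((4 - x : ℝ) : ℂ) := by
    have := trace_mul_add_trace_mul_inv α β
    rw [hy, hx, ← hab] at this
    push_cast
    rcases htr with htr | htr <;> rw [htr] at this <;> linear_combination this
  rw [ht] at hS
  obtain ⟨p, q, hp, hq, -, hpq⟩ := S_real_mono (x := 4 - x) (by linarith) N
  rw [show ((N + 1 : ℕ) : ℤ) - 1 = N by push_cast; ring,
    show ((N + 1 : ℕ) : ℤ) - 2 = N - 1 by push_cast; ring, hp, hq] at hS
  have : q = p := by exact_mod_cast hS
  linarith

end Nonvanishing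

/-! ### The longitude -/

section Longitude

/-- The automorphism of the free group exchanging the generators. -/
def swapHom : FreeGroup (Fin 2) →* FreeGroup (Fin 2) :=
  FreeGroup.lift fun i => if i = 0 then b else a

theorem swapHom_a : swapHom a = b := by simp [swapHom, a]

theorem swapHom_b : swapHom b = a := by simp [swapHom, b]

theorem pow_mul_eq_of_mul_eq {G : Type*} [Group G] {x z c : G} (h : x * c = c * z⁻¹) (m : ℕ) :
    x ^ m * c = c * (z ^ m)⁻¹ := by
  induction m with
  | zero => simp
  | succ m ih => rw [pow_succ, mul_assoc, h, ← mul_assoc, ih, pow_succ', mul_inv_rev, mul_assoc]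

/-- With X = (βα⁻¹)^m and Z = (β⁻¹α)^m, the swapped word X⁻¹Z⁻¹ is the conjugate of (XZ)⁻¹ by X⁻¹.
Moving letters with Xα = αZ⁻¹ and Xβ = βZ⁻¹ reduces the claim to the given relation. -/
theorem even_swapped_relation {G : Type*} [Group G] {α β : G} {m : ℕ} {n : ℤ}
    (h : ((β * α⁻¹) ^ m * (β⁻¹ * α) ^ m) ^ n * α = β * ((β * α⁻¹) ^ m * (β⁻¹ * α) ^ m) ^ n) :
    α * ((α * β⁻¹) ^ m * (α⁻¹ * β) ^ m) ^ n = ((α * β⁻¹) ^ m * (α⁻¹ * β) ^ m) ^ n * β := by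
  have e1 : (α * β⁻¹) ^ m = ((β * α⁻¹) ^ m)⁻¹ := by rw [← inv_pow]; group
  have e2 : (α⁻¹ * β) ^ m = ((β⁻¹ * α) ^ m)⁻¹ := by rw [← inv_pow]; group
  have ha := pow_mul_eq_of_mul_eq (x := β * α⁻¹) (z := β⁻¹ * α) (c := α) (by group) m
  have hb := pow_mul_eq_of_mul_eq (x := β * α⁻¹) (z := β⁻¹ * α) (c := β) (by group) m
  rw [e1, e2]
  generalize (β * α⁻¹) ^ m = X at *
  generalize (β⁻¹ * α) ^ m = Z at *
  have e3 : X⁻¹ * Z⁻¹ = X⁻¹ * (X * Z)⁻¹ * X⁻¹⁻¹ := by group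
  have e4 : α * ((X * Z) ^ n)⁻¹ = ((X * Z) ^ n)⁻¹ * β := by
    rw [eq_inv_mul_iff_mul_eq, ← mul_assoc, h, mul_inv_cancel_right]
  rw [e3, conj_zpow, inv_zpow]
  generalize hV : (X * Z) ^ n = V at *
  have hc : (X * Z)⁻¹ * V⁻¹ = V⁻¹ * (X * Z)⁻¹ := by
    rw [← hV, ← zpow_neg, ← zpow_neg_one, ← zpow_add, ← zpow_add, add_comm]
  calc α * (X⁻¹ * V⁻¹ * X⁻¹⁻¹) = X⁻¹ * (X * α) * X⁻¹ * V⁻¹ * X := by group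
    _ = X⁻¹ * α * ((X * Z)⁻¹ * V⁻¹) * X := by rw [ha]; group
    _ = X⁻¹ * (α * V⁻¹) * (X * Z)⁻¹ * X := by rw [hc]; group
    _ = X⁻¹ * V⁻¹ * (β * Z⁻¹) * X⁻¹ * X := by rw [e4]; group
    _ = _ := by rw [← hb]; group

/-- For odd words the swapped word is conjugate, by X⁻¹α, to the word itself rather than to its
inverse. -/
theorem odd_swapped_relation {G : Type*} [Group G] {α β : G} {m : ℕ} {n : ℤ}
    (h : ((β * α⁻¹) ^ m * (β * α) * (β⁻¹ * α) ^ m) ^ n * α =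
      β * ((β * α⁻¹) ^ m * (β * α) * (β⁻¹ * α) ^ m) ^ n) :
    α * ((α * β⁻¹) ^ m * (α * β) * (α⁻¹ * β) ^ m) ^ n =
      ((α * β⁻¹) ^ m * (α * β) * (α⁻¹ * β) ^ m) ^ n * β := by
  have e1 : (α * β⁻¹) ^ m = ((β * α⁻¹) ^ m)⁻¹ := by rw [← inv_pow]; group
  have e2 : (α⁻¹ * β) ^ m = ((β⁻¹ * α) ^ m)⁻¹ := by rw [← inv_pow]; group
  have ha := pow_mul_eq_of_mul_eq (x := β * α⁻¹) (z := β⁻¹ * α) (c := α) (by group) m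
  have hb := pow_mul_eq_of_mul_eq (x := β * α⁻¹) (z := β⁻¹ * α) (c := β) (by group) m
  rw [e1, e2]
  generalize (β * α⁻¹) ^ m = X at *
  generalize (β⁻¹ * α) ^ m = Z at *
  have hw : X * (β * α) * Z = β * (Z⁻¹ * X⁻¹) * α := by
    have hb' : X * β = β * Z⁻¹ := hb
    have ha' : α * Z = X⁻¹ * α := by
      rw [eq_inv_mul_iff_mul_eq, ← mul_assoc, ha, inv_mul_cancel_right]
    calc X * (β * α) * Z = (X * β) * (α * Z) := by group
      _ = _ := by rw [hb', ha']; group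
  have e3 : X⁻¹ * (α * β) * Z⁻¹ = (X⁻¹ * α) * (X * (β * α) * Z) * (X⁻¹ * α)⁻¹ := by
    rw [hw]; group
  rw [e3, conj_zpow]
  have e5 : (Z⁻¹ * X⁻¹) * α = β⁻¹ * (X * (β * α) * Z) := by rw [hw]; group
  have e6 : β * (Z⁻¹ * X⁻¹) = X * (β * α) * Z * α⁻¹ := by rw [hw]; group
  generalize X * (β * α) * Z = W at *
  have e4 : β⁻¹ * W ^ n = W ^ n * α⁻¹ := by
    rw [inv_mul_eq_iff_eq_mul, ← mul_assoc, ← h, mul_inv_cancel_right]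
  have hc : W * W ^ n = W ^ n * W := by rw [← zpow_one_add, ← zpow_add_one, add_comm]
  calc α * (X⁻¹ * α * W ^ n * (X⁻¹ * α)⁻¹)
      = X⁻¹ * (X * α) * X⁻¹ * α * W ^ n * α⁻¹ * X := by group
    _ = X⁻¹ * α * (Z⁻¹ * X⁻¹ * α) * W ^ n * α⁻¹ * X := by rw [ha]; group
    _ = X⁻¹ * α * β⁻¹ * (W * W ^ n) * α⁻¹ * X := by rw [e5]; group
    _ = X⁻¹ * α * (β⁻¹ * W ^ n) * W * α⁻¹ * X := by rw [hc]; group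
    _ = X⁻¹ * α * W ^ n * α⁻¹ * (W * α⁻¹) * X := by rw [e4]; group
    _ = X⁻¹ * α * W ^ n * α⁻¹ * (β * Z⁻¹) := by rw [← e6]; group
    _ = _ := by rw [← hb]; group

variable {k : ℕ} {n : ℤ}

/-- The word of the longitude, up to a power of the meridian `a`. -/
def longitude (k : ℕ) (n : ℤ) : FreeGroup (Fin 2) := swapHom (w k ^ n) * w k ^ n

theorem swapped_relation :
    proj k n a * proj k n (swapHom (w k ^ n)) = proj k n (swapHom (w k ^ n)) * proj k n b := by
  have h := proj_relation (k := k) (n := n)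
  rw [map_zpow, map_zpow]
  rcases Nat.even_or_odd' k with ⟨m, rfl | rfl⟩
  · rw [w_even] at h ⊢
    simp only [map_mul, map_pow, map_inv, swapHom_a, swapHom_b] at h ⊢
    exact even_swapped_relation h
  · rw [w_odd] at h ⊢
    simp only [map_mul, map_pow, map_inv, swapHom_a, swapHom_b] at h ⊢
    exact odd_swapped_relation h

theorem longitude_comm :
    proj k n (longitude k n) * proj k n a = proj k n a * proj k n (longitude k n) := by
  have h := proj_relation (k := k) (n := n)
  rw [← map_zpow] at h
  rw [longitude, map_mul, mul_assoc, h, ← mul_assoc, ← swapped_relation, mul_assoc]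

theorem expo_zpow (g : FreeGroup (Fin 2)) (i : ℤ) : expo k n (g ^ i) = i * expo k n g := by
  simp [expo]

/-- The exponent is 0 or 4n. Divisibility by 4 is what leaves an even term 2s, which dies modulo 2,
in `zpow_mul_longitude_eq_one`. -/
theorem four_dvd_expo_longitude : ∃ s, expo k n (longitude k n) = 4 * s := by
  rw [longitude, map_zpow, expo_mul, expo_zpow, expo_zpow]
  rcases Nat.even_or_odd' k with ⟨m, rfl | rfl⟩
  · refine ⟨0, ?_⟩
    rw [expo_w_even, w_even]
    simp [expo_mul, expo_pow, expo_inv, swapHom_a, swapHom_b, expo_a, expo_b]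
  · refine ⟨n, ?_⟩
    rw [expo_w_odd, w_odd]
    simp [expo_mul, expo_pow, expo_inv, swapHom_a, swapHom_b, expo_a, expo_b]
    ring

end Longitude

/-! ### Parabolic representations over commutative rings -/

section Riley

variable {R : Type*} [CommRing R]

/-- The unipotent upper triangular matrix `[1 x; 0 1]`. -/
def unipMat (x : R) : SL(2, R) := ⟨!![1, x; 0, 1], by simp⟩

theorem unipMat_add (x y : R) : unipMat (x + y) = unipMat x * unipMat y := by
  apply Subtype.ext
  rw [Matrix.SpecialLinearGroup.coe_mul]
  ext i j
  fin_cases i <;> fin_cases j <;>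
    simp [unipMat, Matrix.mul_apply, Fin.sum_univ_two, add_comm]

/-- The unipotent upper triangular matrices. -/
def unip : Multiplicative R →* SL(2, R) where
  toFun x := unipMat (Multiplicative.toAdd x)
  map_one' := by
    apply Subtype.ext
    exact Matrix.one_fin_two.symm
  map_mul' x y := unipMat_add _ _

theorem coe_unip (x : R) : (unip (Multiplicative.ofAdd x)).1 = !![1, x; 0, 1] := rfl

/-- `a ↦ [1 1; 0 1]`. -/
def rileyA : SL(2, R) := unip (Multiplicative.ofAdd 1)

/-- `b ↦ [1 0; -u 1]`. -/
def rileyB (u : R) : SL(2, R) := ⟨!![1, 0; -u, 1], by simp⟩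

theorem coe_rileyA : (rileyA : SL(2, R)).1 = !![1, 1; 0, 1] := rfl

theorem coe_rileyB (u : R) : (rileyB u).1 = !![1, 0; -u, 1] := rfl

/-- The parabolic representation of the free group with parameter `u`. -/
def riley (u : R) : FreeGroup (Fin 2) →* SL(2, R) :=
  FreeGroup.lift fun i => if i = 0 then rileyA else rileyB u

theorem riley_a (u : R) : riley u a = rileyA := by simp [riley, a]

theorem riley_b (u : R) : riley u b = rileyB u := by simp [riley, b]

theorem riley_map {R' : Type*} [CommRing R'] (φ : R →+* R') (u : R) (g : FreeGroup (Fin 2)) :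
    (riley (φ u) g).1 = (riley u g).1.map φ := by
  have h : riley (φ u) = (Matrix.SpecialLinearGroup.map φ).comp (riley u) := by
    ext y : 1
    fin_cases y
    · change riley (φ u) a = Matrix.SpecialLinearGroup.map φ (riley u a)
      rw [riley_a, riley_a]
      apply Subtype.ext
      rw [Matrix.SpecialLinearGroup.map_apply_coe]
      ext i j
      fin_cases i <;> fin_cases j <;> simp [coe_rileyA]
    · change riley (φ u) b = Matrix.SpecialLinearGroup.map φ (riley u b)
      rw [riley_b, riley_b]
      apply Subtype.ext
      rw [Matrix.SpecialLinearGroup.map_apply_coe]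
      ext i j
      fin_cases i <;> fin_cases j <;> simp [coe_rileyB]
  rw [h]
  rfl

/-- Compatibility of two matrices under transposition twisted by `diag (1, -u)`. -/
def Palin (u : R) (g h : SL(2, R)) : Prop := g.1 * !![1, 0; 0, -u] = !![1, 0; 0, -u] * h.1.transpose

theorem Palin.mul {u : R} {g g' h h' : SL(2, R)} (H : Palin u g h) (H' : Palin u g' h') :
    Palin u (g * g') (h' * h) := by
  rw [Palin, Matrix.SpecialLinearGroup.coe_mul, Matrix.SpecialLinearGroup.coe_mul,
    Matrix.transpose_mul, mul_assoc, H', ← mul_assoc, H, mul_assoc]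

theorem Palin.inv {u : R} {g h : SL(2, R)} (H : Palin u g h) : Palin u g⁻¹ h⁻¹ := by
  have h1 : (g⁻¹).1 * g.1 = 1 := by
    rw [← Matrix.SpecialLinearGroup.coe_mul, inv_mul_cancel]; rfl
  have h2 : h.1.transpose * (h⁻¹).1.transpose = 1 := by
    rw [← Matrix.transpose_mul, ← Matrix.SpecialLinearGroup.coe_mul, inv_mul_cancel]
    exact Matrix.transpose_one
  have H' : g.1 * !![1, 0; 0, -u] = !![1, 0; 0, -u] * h.1.transpose := H
  calc (g⁻¹).1 * !![1, 0; 0, -u]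
      = (g⁻¹).1 * (!![1, 0; 0, -u] * h.1.transpose) * (h⁻¹).1.transpose := by
        rw [mul_assoc, mul_assoc, h2, mul_one]
    _ = _ := by rw [← H', ← mul_assoc, h1, one_mul]

theorem Palin.pow {u : R} {g h : SL(2, R)} (H : Palin u g h) (m : ℕ) :
    Palin u (g ^ m) (h ^ m) := by
  induction m with
  | zero => simp [Palin]
  | succ m ih =>
    rw [pow_succ, pow_succ']
    exact ih.mul H

theorem Palin.zpow {u : R} {g h : SL(2, R)} (H : Palin u g h) (m : ℤ) :
    Palin u (g ^ m) (h ^ m) := by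
  cases m with
  | ofNat m => simpa using H.pow m
  | negSucc m => simpa [zpow_negSucc] using (H.pow (m + 1)).inv

theorem palin_a_b (u : R) : Palin u rileyA (rileyB u) := by
  rw [Palin, coe_rileyA, coe_rileyB]
  ext i j; fin_cases i <;> fin_cases j <;> simp [Matrix.mul_apply, Fin.sum_univ_two]

theorem palin_b_a (u : R) : Palin u (rileyB u) rileyA := by
  rw [Palin, coe_rileyA, coe_rileyB]
  ext i j; fin_cases i <;> fin_cases j <;> simp [Matrix.mul_apply, Fin.sum_univ_two]

/-- The word w is fixed by the anti-automorphism of the free group exchanging a and b, which on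
matrices is transposition twisted by diag(1, −u). -/
theorem palin_w (u : R) (k : ℕ) : Palin u (riley u (w k)) (riley u (w k)) := by
  have hx := (palin_b_a u).mul (palin_a_b u).inv
  have hz := (palin_b_a u).inv.mul (palin_a_b u)
  rcases Nat.even_or_odd' k with ⟨m, rfl | rfl⟩
  · simp only [w_even, map_mul, map_pow, map_inv, riley_a, riley_b]
    exact (hx.pow m).mul (hz.pow m)
  · simp only [w_odd, map_mul, map_pow, map_inv, riley_a, riley_b]
    have := ((hx.pow m).mul ((palin_b_a u).mul (palin_a_b u))).mul (hz.pow m)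
    simpa only [mul_assoc] using this

theorem riley_w_zpow_entries (u : R) (k : ℕ) (n : ℤ) :
    (riley u (w k ^ n)).1 1 0 = -u * (riley u (w k ^ n)).1 0 1 := by
  have h := congrFun (congrFun ((palin_w u k).zpow n) 1) 0
  rw [← map_zpow] at h
  simpa [Matrix.mul_apply, Fin.sum_univ_two] using h

/-- The palindromic symmetry makes the lower-left entry of wⁿ equal to −u times the upper-right one.
The four equations of wⁿa = bwⁿ then collapse to the vanishing of the upper-left entry. -/
theorem riley_r {u : R} {k : ℕ} {n : ℤ} (h : (riley u (w k ^ n)).1 0 0 = 0) :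
    riley u (r k n) = 1 := by
  have e : riley u (w k ^ n) * rileyA = rileyB u * riley u (w k ^ n) := by
    have h1 := riley_w_zpow_entries u k n
    generalize riley u (w k ^ n) = v at *
    apply Subtype.ext
    rw [Matrix.SpecialLinearGroup.coe_mul, Matrix.SpecialLinearGroup.coe_mul, coe_rileyA,
      coe_rileyB]
    ext i j
    fin_cases i <;> fin_cases j <;> simp [Matrix.mul_apply, Fin.sum_univ_two, h, h1]
  rw [r_eq, map_mul, map_mul, map_mul, map_inv, map_inv, riley_a, riley_b, e,
    mul_inv_cancel_right, mul_inv_cancel]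

/-- The parabolic representation of the knot group attached to a root of the Riley polynomial. -/
def rileyRep {u : R} {k : ℕ} {n : ℤ} (h : (riley u (w k ^ n)).1 0 0 = 0) :
    KnotGroup k n →* SL(2, R) :=
  PresentedGroup.toGroup (f := fun i : Fin 2 => if i = 0 then rileyA else rileyB u) (by
    intro s hs
    rw [Set.mem_singleton_iff] at hs
    subst hs
    exact riley_r h)

theorem rileyRep_proj {u : R} {k : ℕ} {n : ℤ} (h : (riley u (w k ^ n)).1 0 0 = 0)
    (g : FreeGroup (Fin 2)) : rileyRep h (proj k n g) = riley u g := rfl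

/-- The intertwining matrix exchanges the two generators; this expresses the swapped half of the
longitude through the entries of wⁿ. -/
theorem swap_riley (u : R) (g : FreeGroup (Fin 2)) :
    !![0, 1; -u, 0] * (riley u g).1 = (riley u (swapHom g)).1 * !![0, 1; -u, 0] := by
  induction g using FreeGroup.induction_on with
  | C1 => simp
  | of y =>
    fin_cases y
    · change _ * (riley u a).1 = (riley u (swapHom a)).1 * _
      rw [swapHom_a, riley_a, riley_b, coe_rileyA, coe_rileyB]
      ext i j; fin_cases i <;> fin_cases j <;> simp [Matrix.mul_apply, Fin.sum_univ_two]
    · change _ * (riley u b).1 = (riley u (swapHom b)).1 * _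
      rw [swapHom_b, riley_a, riley_b, coe_rileyA, coe_rileyB]
      ext i j; fin_cases i <;> fin_cases j <;> simp [Matrix.mul_apply, Fin.sum_univ_two]
  | inv_of y ih =>
    generalize FreeGroup.of y = g at *
    have h1 : (riley u g).1 * (riley u g⁻¹).1 = 1 := by
      rw [← Matrix.SpecialLinearGroup.coe_mul, ← map_mul, mul_inv_cancel, map_one]; rfl
    have h2 : (riley u (swapHom g⁻¹)).1 * (riley u (swapHom g)).1 = 1 := by
      rw [← Matrix.SpecialLinearGroup.coe_mul, ← map_mul, ← map_mul, inv_mul_cancel, map_one,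
        map_one]; rfl
    calc !![0, 1; -u, 0] * (riley u g⁻¹).1
        = (riley u (swapHom g⁻¹)).1 * ((riley u (swapHom g)).1 * !![0, 1; -u, 0]) *
          (riley u g⁻¹).1 := by rw [← mul_assoc _ _ !![0, 1; -u, 0], h2, one_mul]
      _ = _ := by rw [← ih, mul_assoc, mul_assoc, h1, mul_one]
  | mul g h hg hh =>
    rw [map_mul, map_mul, map_mul, Matrix.SpecialLinearGroup.coe_mul,
      Matrix.SpecialLinearGroup.coe_mul, ← mul_assoc, hg, mul_assoc, hh, mul_assoc]

/-- The square of the longitude is unipotent. -/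
theorem riley_longitude_sq {u u' : R} {k : ℕ} {n : ℤ} (hu : u * u' = 1)
    (h : (riley u (w k ^ n)).1 0 0 = 0) :
    riley u (longitude k n) ^ 2 = unip (Multiplicative.ofAdd
      (2 * (2 * (riley u (w k ^ n)).1 1 0 * (riley u (w k ^ n)).1 1 1 * u'))) := by
  have h1 := riley_w_zpow_entries u k n
  have hd : (riley u (w k ^ n)).1 0 0 * (riley u (w k ^ n)).1 1 1 -
      (riley u (w k ^ n)).1 0 1 * (riley u (w k ^ n)).1 1 0 = 1 := by
    rw [← Matrix.det_fin_two]; exact (riley u (w k ^ n)).2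
  have hs := swap_riley u (w k ^ n)
  rw [longitude, map_mul]
  generalize riley u (swapHom (w k ^ n)) = V at *
  generalize riley u (w k ^ n) = v at *
  have h00 := congrFun (congrFun hs 0) 0
  have h01 := congrFun (congrFun hs 0) 1
  have h10 := congrFun (congrFun hs 1) 0
  have h11 := congrFun (congrFun hs 1) 1
  simp only [Matrix.mul_apply, Fin.sum_univ_two, Matrix.of_apply, Matrix.cons_val',
    Matrix.cons_val_zero, Matrix.cons_val_one, Matrix.cons_val_fin_one, h, mul_zero, zero_mul,
    zero_add, add_zero, one_mul, mul_one, zero_sub] at h00 h01 h10 h11 hd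
  have V11 : V.1 1 1 = 0 := by linear_combination u' * h10 - V.1 1 1 * hu
  have V01 : V.1 0 1 = -u' * v.1 1 0 := by linear_combination u' * h00 - V.1 0 1 * hu
  have V10 : V.1 1 0 = v.1 1 0 := by rw [h1, ← h11]
  have v01 : v.1 0 1 = -u' * v.1 1 0 := by linear_combination u' * h1 - v.1 0 1 * hu
  have hx : u' * (v.1 1 0 * v.1 1 0) = 1 := by rw [v01] at hd; linear_combination hd
  have hV : (V * v).1 = !![-1, -(2 * v.1 1 0 * v.1 1 1 * u'); 0, -1] := by
    rw [Matrix.SpecialLinearGroup.coe_mul]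
    ext i j
    fin_cases i <;> fin_cases j <;>
      simp [Matrix.mul_apply, Fin.sum_univ_two, h, V11, V01, V10, v01, ← h01]
    · linear_combination hx
    · ring
    · linear_combination hx
  apply Subtype.ext
  rw [sq, Matrix.SpecialLinearGroup.coe_mul, hV, coe_unip]
  ext i j
  fin_cases i <;> fin_cases j <;> simp [Matrix.mul_apply, Fin.sum_univ_two]
  ring

end Riley

/-! ### Independence of meridian and longitude, by reduction modulo 2. -/

section LongitudeOrder

open Polynomial (X)

theorem degree_S (R : Type*) [CommRing R] [Nontrivial R] (j : ℕ) :
    (Polynomial.Chebyshev.S R j).degree = j ∧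
      (Polynomial.Chebyshev.S R ((j : ℤ) - 1)).degree < j := by
  induction j with
  | zero => simp
  | succ j ih =>
    obtain ⟨h1, h2⟩ := ih
    have e : ((j + 1 : ℕ) : ℤ) - 1 = j := by push_cast; ring
    have hX : (X * Polynomial.Chebyshev.S R j).degree = ((j + 1 : ℕ) : WithBot ℕ) := by
      rw [mul_comm, Polynomial.degree_mul_X, h1]; rfl
    have hlt : ((j : ℕ) : WithBot ℕ) < ((j + 1 : ℕ) : WithBot ℕ) := by
      exact_mod_cast Nat.lt_succ_self j
    rw [e, h1]
    refine ⟨?_, hlt⟩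
    push_cast
    rw [Polynomial.Chebyshev.S_add_one, Polynomial.degree_sub_eq_left_of_degree_lt, hX]
    · push_cast; rfl
    · rw [hX]; exact h2.trans hlt

variable {K : Type*} [Field K]

theorem coe_rileyB_mul_rileyA {R : Type*} [CommRing R] (u : R) :
    (rileyB u * rileyA).1 = !![1, 1; -u, 1 - u] := by
  rw [Matrix.SpecialLinearGroup.coe_mul, coe_rileyA, coe_rileyB]
  ext i j
  fin_cases i <;> fin_cases j <;> simp [Matrix.mul_apply, Fin.sum_univ_two]
  ring

theorem exists_rileyB_mul_rileyA_pow [IsAlgClosed K] {M : ℕ} (hM : M ≠ 0) :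
    ∃ u : K, ((rileyB u * rileyA) ^ M).1 1 1 = 0 := by
  obtain ⟨h1, h2⟩ := degree_S K M
  have hdeg : (Polynomial.Chebyshev.S K M - Polynomial.Chebyshev.S K ((M : ℤ) - 1)).degree ≠ 0 := by
    rw [Polynomial.degree_sub_eq_left_of_degree_lt (h1 ▸ h2), h1]
    exact_mod_cast hM
  obtain ⟨t, ht⟩ := IsAlgClosed.exists_root _ hdeg
  -- The product of the two generators has trace 2 − u = t, and the lower-right entry of its M-th
  -- power is S_M(t) − S_{M−1}(t).
  refine ⟨2 - t, ?_⟩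
  rw [pow_eq_chebyshev, coe_rileyB_mul_rileyA]
  rw [Polynomial.IsRoot, Polynomial.Chebyshev.S_eq] at ht
  simp [Matrix.trace_fin_two] at ht ⊢
  have e : 1 + (1 - (2 - t)) = t := by ring
  rw [e]
  linear_combination ht

/-- If both diagonal entries of the power vanished, their difference u S_{M−1} would too. That is up
to sign the lower-left entry, so the determinant would be 0. -/
theorem rileyB_mul_rileyA_pow_ne_zero {u : K} {M : ℕ}
    (h0 : ((rileyB u * rileyA) ^ M).1 0 0 = 0) : ((rileyB u * rileyA) ^ M).1 1 1 ≠ 0 := by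
  intro h1
  have hd : ((rileyB u * rileyA) ^ M).1 0 0 * ((rileyB u * rileyA) ^ M).1 1 1 -
      ((rileyB u * rileyA) ^ M).1 0 1 * ((rileyB u * rileyA) ^ M).1 1 0 = 1 := by
    rw [← Matrix.det_fin_two]; exact ((rileyB u * rileyA) ^ M).2
  rw [h0, h1] at hd
  have h10 : ((rileyB u * rileyA) ^ M).1 1 0 = 0 := by
    have e := pow_eq_chebyshev (rileyB u * rileyA) M
    have e00 := congrFun (congrFun e 0) 0
    have e11 := congrFun (congrFun e 1) 1
    have e10 := congrFun (congrFun e 1) 0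
    rw [h0, coe_rileyB_mul_rileyA] at e00
    rw [h1, coe_rileyB_mul_rileyA] at e11
    rw [coe_rileyB_mul_rileyA] at e10
    rw [e10]
    simp [Matrix.trace_fin_two] at e00 e11 ⊢
    have h2 : (Polynomial.Chebyshev.S K ((M : ℤ) - 1)).eval
        (1 + (1 - u)) * u = 0 := by
      linear_combination e11 - e00
    exact mul_eq_zero.1 h2
  rw [h10] at hd
  simp at hd

/-- In characteristic 2 both unipotent generators are involutions, so ba⁻¹, b⁻¹a and ba have the
same image. -/
theorem riley_w_char_two [CharP K 2] (u : K) (k : ℕ) :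
    riley u (w k) = (rileyB u * rileyA) ^ k := by
  have h2 : (1 : K) + 1 = 0 := by rw [one_add_one_eq_two]; exact CharP.cast_eq_zero K 2
  have ha : (rileyA : SL(2, K))⁻¹ = rileyA := by
    rw [inv_eq_iff_mul_eq_one]
    apply Subtype.ext
    rw [Matrix.SpecialLinearGroup.coe_mul, coe_rileyA]
    ext i j
    fin_cases i <;> fin_cases j <;> simp [Matrix.mul_apply, Fin.sum_univ_two, h2]
  have hb : (rileyB u)⁻¹ = rileyB u := by
    rw [inv_eq_iff_mul_eq_one]
    apply Subtype.ext
    rw [Matrix.SpecialLinearGroup.coe_mul, coe_rileyB]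
    ext i j
    fin_cases i <;> fin_cases j <;> simp [Matrix.mul_apply, Fin.sum_univ_two]
    linear_combination (-u) * h2
  rcases Nat.even_or_odd' k with ⟨m, rfl | rfl⟩
  · simp only [w_even, map_mul, map_pow, map_inv, riley_a, riley_b, ha, hb]
    rw [two_mul, pow_add]
  · simp only [w_odd, map_mul, map_pow, map_inv, riley_a, riley_b, ha, hb]
    rw [← pow_succ, ← pow_add]
    congr 1; ring

theorem riley_w_zpow_char_two [CharP K 2] (u : K) (k N : ℕ) :
    riley u (w k ^ (-N : ℤ)) = ((rileyB u * rileyA) ^ (k * N))⁻¹ := by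
  rw [map_zpow, riley_w_char_two, zpow_neg, zpow_natCast, pow_mul]

theorem riley_char_two_ne_zero [CharP K 2] {u : K} {k N : ℕ}
    (h : (riley u (w k ^ (-N : ℤ))).1 0 0 = 0) : (riley u (w k ^ (-N : ℤ))).1 1 1 ≠ 0 := by
  rw [riley_w_zpow_char_two, Matrix.SpecialLinearGroup.coe_inv, Matrix.adjugate_fin_two] at h ⊢
  intro h'
  exact rileyB_mul_rileyA_pow_ne_zero (by simpa using h') (by simpa using h)

theorem exists_riley_char_two [CharP K 2] [IsAlgClosed K] {k N : ℕ} (hk : k ≠ 0) (hN : N ≠ 0) :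
    ∃ u : K, (riley u (w k ^ (-N : ℤ))).1 0 0 = 0 := by
  obtain ⟨u, hu⟩ := exists_rileyB_mul_rileyA_pow (K := K) (mul_ne_zero hk hN)
  refine ⟨u, ?_⟩
  rw [riley_w_zpow_char_two, Matrix.SpecialLinearGroup.coe_inv, Matrix.adjugate_fin_two]
  simpa using hu

theorem riley_zero {R : Type*} [CommRing R] (g : FreeGroup (Fin 2)) :
    ∃ x : Multiplicative R, riley (0 : R) g = unip x := by
  induction g using FreeGroup.induction_on with
  | C1 => exact ⟨1, by simp⟩
  | of y =>
    fin_cases y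
    · exact ⟨_, riley_a 0⟩
    · refine ⟨1, ?_⟩
      change riley 0 b = _
      rw [riley_b, map_one]
      apply Subtype.ext
      rw [coe_rileyB, neg_zero]
      exact Matrix.one_fin_two.symm
  | inv_of y ih =>
    obtain ⟨x, hx⟩ := ih
    exact ⟨x⁻¹, by rw [map_inv, map_inv, hx]⟩
  | mul g h hg hh =>
    obtain ⟨x, hx⟩ := hg
    obtain ⟨y, hy⟩ := hh
    exact ⟨x * y, by rw [map_mul, map_mul, hx, hy]⟩

/-- The Riley polynomial of the knot group. -/
def rileyPoly (k : ℕ) (n : ℤ) : Polynomial ℤ := (riley (X : Polynomial ℤ) (w k ^ n)).1 0 0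

theorem rileyPoly_map {R : Type*} [CommRing R] (φ : Polynomial ℤ →+* R) (k : ℕ) (n : ℤ) :
    (riley (φ X) (w k ^ n)).1 0 0 = φ (rileyPoly k n) := by
  rw [riley_map]; rfl

theorem rileyPoly_eval_zero (k : ℕ) (n : ℤ) : (rileyPoly k n).eval 0 = 1 := by
  have h := rileyPoly_map (Polynomial.evalRingHom (0 : ℤ)) k n
  rw [Polynomial.coe_evalRingHom, Polynomial.eval_X] at h
  rw [← h]
  obtain ⟨x, hx⟩ := riley_zero (R := ℤ) (w k ^ n)
  rw [hx]
  rfl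

/-- A common divisor of f and a nonzero constant is itself constant and divides f(0) = 1, hence is a
unit. This makes the Riley ring torsion-free. -/
theorem dvd_of_dvd_C_mul {f p : Polynomial ℤ} {j : ℤ} (hf : f.eval 0 = 1) (hj : j ≠ 0)
    (h : f ∣ Polynomial.C j * p) : f ∣ p := by
  refine IsRelPrime.dvd_of_dvd_mul_left ?_ h
  intro d hd hdj
  have hdeg : d.natDegree = 0 := by
    have := Polynomial.natDegree_le_of_dvd hdj (by simpa using hj)
    rw [Polynomial.natDegree_C] at this
    omega
  obtain ⟨c, rfl⟩ := Polynomial.natDegree_eq_zero.1 hdeg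
  obtain ⟨q, hq⟩ := hd
  have := congrArg (Polynomial.eval 0) hq
  rw [hf, Polynomial.eval_mul, Polynomial.eval_C] at this
  exact (IsUnit.of_mul_eq_one _ this.symm).map Polynomial.C

/-- The coordinate ring of the parabolic representations. -/
abbrev RileyRing (k : ℕ) (n : ℤ) : Type := AdjoinRoot (rileyPoly k n)

variable {k : ℕ} {n : ℤ}

theorem rileyRing_torsion {j : ℤ} (hj : j ≠ 0) {x : RileyRing k n}
    (h : (j : RileyRing k n) * x = 0) :
    x = 0 := by
  obtain ⟨p, rfl⟩ := AdjoinRoot.mk_surjective x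
  have e : (j : RileyRing k n) = AdjoinRoot.mk (rileyPoly k n) (Polynomial.C j) := by simp
  rw [e, ← map_mul, AdjoinRoot.mk_eq_zero] at h
  exact AdjoinRoot.mk_eq_zero.2 (dvd_of_dvd_C_mul (rileyPoly_eval_zero k n) hj h)

theorem rileyRing_zero : (riley (AdjoinRoot.root (rileyPoly k n)) (w k ^ n)).1 0 0 = 0 := by
  have h := rileyPoly_map (AdjoinRoot.mk (rileyPoly k n)) k n
  rwa [AdjoinRoot.mk_X, AdjoinRoot.mk_self] at h

theorem rileyRing_unit : ∃ u', AdjoinRoot.root (rileyPoly k n) * u' = 1 := by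
  have h : X ∣ rileyPoly k n - 1 := by
    rw [Polynomial.X_dvd_iff, Polynomial.coeff_zero_eq_eval_zero]
    simp [rileyPoly_eval_zero]
  obtain ⟨q, hq⟩ := h
  refine ⟨AdjoinRoot.mk _ (-q), ?_⟩
  have e : X * -q = 1 - rileyPoly k n := by linear_combination hq
  rw [← AdjoinRoot.mk_X, ← map_mul, e, map_sub, AdjoinRoot.mk_self, sub_zero, map_one]

theorem exists_rileyRing_hom (hk : k ≠ 0) (N : ℕ) (hN : N ≠ 0) (hn : n = -N) :
    ∃ φ : RileyRing k n →+* AlgebraicClosure (ZMod 2),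
      φ ((riley (AdjoinRoot.root (rileyPoly k n)) (w k ^ n)).1 1 1) ≠ 0 := by
  subst hn
  obtain ⟨θ, hθ⟩ := exists_riley_char_two (K := AlgebraicClosure (ZMod 2)) hk hN
  have h := rileyPoly_map (Polynomial.eval₂RingHom (Int.castRingHom (AlgebraicClosure (ZMod 2))) θ)
    k (-N)
  rw [Polynomial.coe_eval₂RingHom, Polynomial.eval₂_X, hθ] at h
  refine ⟨AdjoinRoot.lift (Int.castRingHom _) θ h.symm, ?_⟩
  have e := riley_map (AdjoinRoot.lift (Int.castRingHom _) θ h.symm)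
    (AdjoinRoot.root (rileyPoly k (-N))) (w k ^ (-N : ℤ))
  rw [AdjoinRoot.lift_root] at e
  have e11 := congrFun (congrFun e 1) 1
  rw [Matrix.map_apply] at e11
  rw [← e11]
  exact riley_char_two_ne_zero hθ

/-- Abelianising gives i = −4js. In the Riley ring a² and λ² are unipotent, so the relation becomes
linear in their upper-right entries. If j ≠ 0, torsion-freeness gives v₁₀ v₁₁ u⁻¹ = 2s for v the
image of wⁿ, yet the left side is nonzero under a homomorphism to characteristic 2. -/
theorem zpow_mul_longitude_eq_one (hk : k ≠ 0) (N : ℕ) (hN : N ≠ 0) (hn : n = -N) {i j : ℤ}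
    (h : proj k n a ^ i * proj k n (longitude k n) ^ j = 1) : i = 0 ∧ j = 0 := by
  obtain ⟨s, hs⟩ := four_dvd_expo_longitude (k := k) (n := n)
  have hexp : i + j * (4 * s) = 0 := by
    have : expo k n (a ^ i * longitude k n ^ j) = 0 := by
      rw [expo, map_mul, map_zpow, map_zpow, h]; simp
    rwa [expo_mul, expo_zpow, expo_zpow, expo_a, mul_one, hs] at this
  suffices hj : j = 0 by
    subst hj
    exact ⟨by simpa using hexp, rfl⟩
  by_contra hj
  obtain ⟨φ, hφ⟩ := exists_rileyRing_hom hk N hN hn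
  obtain ⟨u', hu'⟩ := rileyRing_unit (k := k) (n := n)
  have h0 := rileyRing_zero (k := k) (n := n)
  have hl := riley_longitude_sq hu' h0
  have hdet : (riley (AdjoinRoot.root (rileyPoly k n)) (w k ^ n)).1 0 0 *
      (riley (AdjoinRoot.root (rileyPoly k n)) (w k ^ n)).1 1 1 -
      (riley (AdjoinRoot.root (rileyPoly k n)) (w k ^ n)).1 0 1 *
      (riley (AdjoinRoot.root (rileyPoly k n)) (w k ^ n)).1 1 0 = 1 := by
    rw [← Matrix.det_fin_two]; exact (riley _ (w k ^ n)).2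
  have hcomm := congrArg (rileyRep h0) (longitude_comm (k := k) (n := n))
  have himg := congrArg (rileyRep h0) h
  rw [map_mul, map_mul, rileyRep_proj, rileyRep_proj] at hcomm
  rw [map_mul, map_zpow, map_zpow, map_one, rileyRep_proj, rileyRep_proj] at himg
  -- The longitude itself maps to minus a unipotent matrix; squaring removes the sign.
  have hsq : (riley (AdjoinRoot.root (rileyPoly k n)) a ^ 2) ^ i *
      (riley (AdjoinRoot.root (rileyPoly k n)) (longitude k n) ^ 2) ^ j = 1 := by
    have hc : Commute (riley (AdjoinRoot.root (rileyPoly k n)) a ^ i)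
        (riley (AdjoinRoot.root (rileyPoly k n)) (longitude k n) ^ j) :=
      (Commute.zpow_zpow hcomm.symm i j)
    rw [← zpow_natCast, ← zpow_natCast, ← zpow_mul, ← zpow_mul, mul_comm _ i, mul_comm _ j,
      zpow_mul, zpow_mul, ← hc.mul_zpow, himg, one_zpow]
  rw [hl, riley_a, rileyA, ← map_pow, ← map_zpow, ← map_zpow, ← map_mul] at hsq
  generalize riley (AdjoinRoot.root (rileyPoly k n)) (w k ^ n) = v at *
  have h01 := congrFun (congrFun (congrArg Subtype.val hsq) 0) 1
  change (i • ((2 : ℕ) • (1 : RileyRing k n)) + j • (2 * (2 * v.1 1 0 * v.1 1 1 * u')) :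
    RileyRing k n) = (1 : Matrix (Fin 2) (Fin 2) (RileyRing k n)) 0 1 at h01
  simp only [zsmul_eq_mul, nsmul_eq_mul, mul_one, Nat.cast_ofNat, Matrix.one_apply_ne,
    ne_eq, zero_ne_one, not_false_eq_true] at h01
  have hi : (i : RileyRing k n) = -(j * (4 * s)) := by
    have : i = -(j * (4 * s)) := by linear_combination hexp
    rw [this]; push_cast; ring
  have hj4 : ((4 * j : ℤ) : RileyRing k n) * (v.1 1 0 * v.1 1 1 * u' - 2 * s) = 0 := by
    push_cast
    rw [hi] at h01
    linear_combination h01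
  have hz := rileyRing_torsion (mul_ne_zero four_ne_zero hj) hj4
  have hφz := congrArg φ hz
  have h2 : (2 : AlgebraicClosure (ZMod 2)) = 0 := CharP.cast_eq_zero _ 2
  simp only [map_sub, map_mul, map_ofNat, map_zero, h2, zero_mul, sub_zero] at hφz
  have hu0 : φ u' ≠ 0 := by
    intro h
    have := congrArg φ hu'
    rw [map_mul, h, mul_zero, map_one] at this
    exact zero_ne_one this
  have hx0 : φ (v.1 1 0) ≠ 0 := by
    intro h
    have := congrArg φ hdet
    rw [h0, map_sub, map_mul, map_mul, h, map_one, map_zero, mul_zero, zero_mul, sub_zero] at this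
    exact zero_ne_one this
  exact mul_ne_zero (mul_ne_zero hx0 hφ) hu0 hφz

theorem proj_a_ne_proj_b (hk : k ≠ 0) (N : ℕ) (hN : N ≠ 0) (hn : n = -N) :
    proj k n a ≠ proj k n b := by
  intro h
  obtain ⟨φ, -⟩ := exists_rileyRing_hom hk N hN hn
  have h1 := congrArg (rileyRep (rileyRing_zero (k := k) (n := n))) h
  rw [rileyRep_proj, rileyRep_proj, riley_a, riley_b] at h1
  have h01 := congrFun (congrFun (congrArg Subtype.val h1) 0) 1
  have h10 : (1 : RileyRing k n) = 0 := h01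
  have := congrArg φ h10
  rw [map_one, map_zero] at this
  exact one_ne_zero this

end LongitudeOrder

/-! ### Diagonalisation and compactness in discrete subgroups. -/

/-! ### Commuting elements in discrete subgroups of `SL₂(ℂ)` -/

section Discrete

/-- The diagonal matrix `diag (x, x⁻¹)`. -/
def diagUnit (x : ℂˣ) : SL(2, ℂ) := ⟨!![(x : ℂ), 0; 0, (x⁻¹ : ℂˣ)], by simp⟩

theorem diagUnit_mul (x y : ℂˣ) : diagUnit (x * y) = diagUnit x * diagUnit y := by
  apply Subtype.ext
  rw [Matrix.SpecialLinearGroup.coe_mul]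
  ext i j
  fin_cases i <;> fin_cases j <;>
    simp [diagUnit, Matrix.mul_apply, Fin.sum_univ_two, mul_comm]

/-- `diagUnit` as a homomorphism. -/
def diagMat : ℂˣ →* SL(2, ℂ) where
  toFun := diagUnit
  map_one' := by
    apply Subtype.ext
    simp [diagUnit, Matrix.one_fin_two]
  map_mul' := diagUnit_mul

theorem coe_diagMat (x : ℂˣ) : (diagMat x).1 = !![(x : ℂ), 0; 0, (x⁻¹ : ℂˣ)] := rfl

theorem continuous_diagMat : Continuous diagMat := by
  refine Continuous.subtype_mk (f := fun x : ℂˣ => !![(x : ℂ), 0; 0, (x⁻¹ : ℂˣ)]) ?_ _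
  refine continuous_matrix fun i j => ?_
  fin_cases i <;> fin_cases j
  · exact Units.continuous_val
  · exact continuous_const
  · exact continuous_const
  · exact Units.continuous_val.comp continuous_inv

theorem exists_diag_of_trace {g : SL(2, ℂ)} (h2 : g.1.trace ≠ 2) (h2' : g.1.trace ≠ -2) :
    ∃ (P : SL(2, ℂ)) (x : ℂˣ), g = P * diagMat x * P⁻¹ ∧ (x : ℂ) ≠ (x⁻¹ : ℂˣ) := by
  obtain ⟨h, t, rfl, ht⟩ := exists_conj_upper g
  rw [trace_conj, Matrix.trace_fin_two] at h2 h2'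
  have hd := det_eq_one t
  rw [ht, mul_zero, sub_zero] at hd
  let x : ℂˣ := ⟨t.1 0 0, t.1 1 1, hd, by rw [mul_comm, hd]⟩
  have hx : (x : ℂ) = t.1 0 0 := rfl
  have hx' : ((x⁻¹ : ℂˣ) : ℂ) = t.1 1 1 := rfl
  have hne : t.1 0 0 ≠ t.1 1 1 := by
    intro e
    rw [← e] at hd h2 h2'
    rcases mul_self_eq_one_iff.1 hd with h1 | h1
    · exact h2 (by rw [h1]; norm_num)
    · exact h2' (by rw [h1]; norm_num)
  -- Conjugation by this unipotent matrix removes the off-diagonal entry of t, its two eigenvalues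
  -- being distinct.
  refine ⟨h * unipMat (t.1 0 1 / (t.1 1 1 - t.1 0 0)), x, ?_, hne⟩
  have hsub : t.1 1 1 - t.1 0 0 ≠ 0 := sub_ne_zero.2 hne.symm
  have key : t * unipMat (t.1 0 1 / (t.1 1 1 - t.1 0 0)) =
      unipMat (t.1 0 1 / (t.1 1 1 - t.1 0 0)) * diagMat x := by
    apply Subtype.ext
    rw [Matrix.SpecialLinearGroup.coe_mul, Matrix.SpecialLinearGroup.coe_mul, coe_diagMat, hx, hx']
    ext i j
    fin_cases i <;> fin_cases j <;>
      simp [Matrix.mul_apply, Fin.sum_univ_two, unipMat, ht]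
    field_simp
    ring
  have e := eq_mul_inv_of_mul_eq key
  calc h * t * h⁻¹ = h * (unipMat (t.1 0 1 / (t.1 1 1 - t.1 0 0)) * diagMat x *
        (unipMat (t.1 0 1 / (t.1 1 1 - t.1 0 0)))⁻¹) * h⁻¹ := by rw [← e]
    _ = _ := by group

theorem exists_diag_of_commute {g : SL(2, ℂ)} {x : ℂˣ} (hx : (x : ℂ) ≠ (x⁻¹ : ℂˣ))
    (hc : g * diagMat x = diagMat x * g) : ∃ y : ℂˣ, g = diagMat y := by
  have h := congrArg Subtype.val hc
  rw [Matrix.SpecialLinearGroup.coe_mul, Matrix.SpecialLinearGroup.coe_mul, coe_diagMat] at h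
  have h01 := congrFun (congrFun h 0) 1
  have h10 := congrFun (congrFun h 1) 0
  have hd := det_eq_one g
  simp only [Matrix.mul_apply, Fin.sum_univ_two, Matrix.of_apply, Matrix.cons_val',
    Matrix.cons_val_zero, Matrix.cons_val_one, Matrix.cons_val_fin_one, mul_zero, zero_mul,
    zero_add, add_zero] at h01 h10
  have hs : (x : ℂ) - (x⁻¹ : ℂˣ) ≠ 0 := sub_ne_zero.2 hx
  have e01 : g.1 0 1 = 0 := by
    refine (mul_eq_zero.1 (?_ : ((x : ℂ) - (x⁻¹ : ℂˣ)) * g.1 0 1 = 0)).resolve_left hs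
    linear_combination -h01
  have e10 : g.1 1 0 = 0 := by
    refine (mul_eq_zero.1 (?_ : ((x : ℂ) - (x⁻¹ : ℂˣ)) * g.1 1 0 = 0)).resolve_left hs
    linear_combination h10
  rw [e01, zero_mul, sub_zero] at hd
  refine ⟨⟨g.1 0 0, g.1 1 1, hd, by rw [mul_comm, hd]⟩, ?_⟩
  apply Subtype.ext
  rw [coe_diagMat]
  ext i j
  fin_cases i <;> fin_cases j <;> simp [e01, e10]

/-- Pigeonhole principle for a pair of reals. -/
theorem exists_injective_bounded (α β : ℝ) :
    ∃ f : ℤ → ℤ × ℤ, Function.Injective f ∧ ∀ i, |(f i).1 * α + (f i).2 * β| ≤ |α| := by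
  by_cases hα : α = 0
  · subst hα
    exact ⟨fun i => (i, 0), fun i j h => congrArg Prod.fst h, fun i => by simp⟩
  -- For each j, take the integer multiple of α nearest to −jβ.
  · refine ⟨fun j => (round (-(j * β) / α), j), fun i j h => congrArg Prod.snd h, fun j => ?_⟩
    have h := abs_sub_round (-(j * β) / α)
    have e : (round (-(j * β) / α) : ℝ) * α + j * β =
        -((-(j * β) / α - round (-(j * β) / α)) * α) := by
      field_simp; ring
    change |(round (-(j * β) / α) : ℝ) * α + j * β| ≤ |α|
    rw [e, abs_neg, abs_mul]
    nlinarith [abs_nonneg α]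

/-- The closed annulus `e^{-c} ≤ |x| ≤ e^c` is compact in `ℂˣ`. -/
theorem isCompact_annulus (c : ℝ) : IsCompact {x : ℂˣ | |Real.log ‖(x : ℂ)‖| ≤ c} := by
  have h1 : IsCompact ((Units.embedProduct ℂ) ⁻¹'
      (Metric.closedBall (0 : ℂ) (Real.exp c) ×ˢ
        (MulOpposite.unop ⁻¹' Metric.closedBall (0 : ℂ) (Real.exp c)))) := by
    refine Units.isClosedEmbedding_embedProduct.isCompact_preimage ?_
    refine (isCompact_closedBall _ _).prod ?_
    exact MulOpposite.opHomeomorph.symm.isClosedEmbedding.isCompact_preimage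
      (isCompact_closedBall _ _)
  refine h1.of_isClosed_subset ?_ ?_
  · refine isClosed_le ?_ continuous_const
    refine Continuous.abs (Continuous.log (Units.continuous_val.norm) fun x => ?_)
    simp
  · intro x hx
    have hpos : 0 < ‖(x : ℂ)‖ := by simp
    have hx' : |Real.log ‖(x : ℂ)‖| ≤ c := hx
    rw [abs_le] at hx'
    refine ⟨?_, ?_⟩
    · simp only [Units.embedProduct_apply, Metric.mem_closedBall, dist_zero_right]
      rw [← Real.exp_log hpos]
      exact Real.exp_le_exp.2 hx'.2
    · simp only [Units.embedProduct_apply, Set.mem_preimage, MulOpposite.unop_op,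
        Metric.mem_closedBall, dist_zero_right, Units.val_inv_eq_inv_val, norm_inv]
      rw [← Real.exp_log hpos, ← Real.exp_neg]
      exact Real.exp_le_exp.2 (by linarith)

/-- In a discrete subgroup of `SL₂(ℂ)`, an element that commutes with an element of trace
`≠ ±2` satisfies a multiplicative relation with it. -/
theorem exists_relation_of_discrete {H : Subgroup SL(2, ℂ)} (hH : DiscreteTopology H)
    {g l : SL(2, ℂ)} (hg : g ∈ H) (hl : l ∈ H) (hc : l * g = g * l)
    (h2 : g.1.trace ≠ 2) (h2' : g.1.trace ≠ -2) :
    ∃ i j : ℤ, (i ≠ 0 ∨ j ≠ 0) ∧ g ^ i * l ^ j = 1 := by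
  obtain ⟨P, x, rfl, hx⟩ := exists_diag_of_trace h2 h2'
  obtain ⟨y, hy⟩ : ∃ y : ℂˣ, P⁻¹ * l * P = diagMat y := by
    refine exists_diag_of_commute hx ?_
    calc P⁻¹ * l * P * diagMat x = P⁻¹ * (l * (P * diagMat x * P⁻¹)) * P := by group
      _ = _ := by rw [hc]; group
  have hl' : l = P * diagMat y * P⁻¹ := by rw [← hy]; group
  subst hl'
  let F : ℂˣ → SL(2, ℂ) := fun z => P * diagMat z * P⁻¹
  have hF : Continuous F := (continuous_const.mul continuous_diagMat).mul continuous_const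
  obtain ⟨f, hf, hfb⟩ := exists_injective_bounded (Real.log ‖(x : ℂ)‖) (Real.log ‖(y : ℂ)‖)
  have hpow : ∀ i j : ℤ, (P * diagMat x * P⁻¹) ^ i * (P * diagMat y * P⁻¹) ^ j =
      F (x ^ i * y ^ j) := by
    intro i j
    simp only [F]
    rw [conj_zpow, conj_zpow, map_mul, map_zpow, map_zpow]
    group
  have hK := (isCompact_annulus |Real.log ‖(x : ℂ)‖|).image hF
  -- A discrete subgroup is closed, so it meets the compact image of the annulus in a finite set.
  -- Infinitely many exponent pairs land there, and two that coincide give the relation.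
  have hclosed : IsClosed (H : Set SL(2, ℂ)) := Subgroup.isClosed_of_discrete
  have hfin : ((H : Set SL(2, ℂ)) ∩
      F '' {z : ℂˣ | |Real.log ‖(z : ℂ)‖| ≤ |Real.log ‖(x : ℂ)‖|}).Finite := by
    refine (hK.inter_left hclosed).finite ?_
    exact IsDiscrete.mono ⟨hH⟩ Set.inter_subset_left
  have hmem : ∀ s : ℤ, F (x ^ (f s).1 * y ^ (f s).2) ∈ (H : Set SL(2, ℂ)) ∩
      F '' {z : ℂˣ | |Real.log ‖(z : ℂ)‖| ≤ |Real.log ‖(x : ℂ)‖|} := by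
    intro s
    refine ⟨?_, ⟨_, ?_, rfl⟩⟩
    · rw [← hpow]
      exact H.mul_mem (H.zpow_mem hg _) (H.zpow_mem hl _)
    · have hb := hfb s
      have hx0 : ‖(x : ℂ)‖ ≠ 0 := by simp
      have hy0 : ‖(y : ℂ)‖ ≠ 0 := by simp
      rw [Set.mem_ofPred_eq, Units.val_mul, Units.val_zpow_eq_zpow_val, Units.val_zpow_eq_zpow_val,
        norm_mul, norm_zpow, norm_zpow, Real.log_mul (zpow_ne_zero _ hx0) (zpow_ne_zero _ hy0),
        Real.log_zpow, Real.log_zpow]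
      exact hb
  obtain ⟨s, t, hst, he⟩ : ∃ s t : ℤ, s ≠ t ∧
      F (x ^ (f s).1 * y ^ (f s).2) = F (x ^ (f t).1 * y ^ (f t).2) := by
    by_contra hcon
    push Not at hcon
    exact Set.infinite_of_injective_forall_mem
      (f := fun s : ℤ => F (x ^ (f s).1 * y ^ (f s).2))
      (fun s t h => by_contra fun hne => hcon s t hne h) hmem hfin
  refine ⟨(f s).1 - (f t).1, (f s).2 - (f t).2, ?_, ?_⟩
  · by_contra h
    push Not at h
    exact hst (hf (Prod.ext (sub_eq_zero.1 h.1) (sub_eq_zero.1 h.2)))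
  · rw [hpow]
    simp only [F] at he ⊢
    have he' := mul_left_cancel (mul_right_cancel he)
    have e : x ^ ((f s).1 - (f t).1) * y ^ ((f s).2 - (f t).2) =
        (x ^ (f s).1 * y ^ (f s).2) * (x ^ (f t).1 * y ^ (f t).2)⁻¹ := by
      rw [zpow_sub, zpow_sub, mul_inv]; exact mul_mul_mul_comm _ _ _ _
    rw [e, map_mul, map_inv, he', mul_inv_cancel]
    group

end Discrete

/-! ### Holonomy representations are parabolic on meridians. -/

section Holonomy

variable {k : ℕ} {n : ℤ}

theorem IsHolonomy.injective {ρ : KnotGroup k n →* SL(2, ℂ)} (h : IsHolonomy ρ) :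
    Function.Injective ρ := by
  have := h.faithful
  rw [MonoidHom.coe_comp] at this
  exact this.of_comp

/-- Holonomy representations send meridians to parabolic elements. -/
theorem IsHolonomy.isNonabelianParabolic {ρ : KnotGroup k n →* SL(2, ℂ)} (h : IsHolonomy ρ)
    (hk : k ≠ 0) (N : ℕ) (hN : N ≠ 0) (hn : n = -N) : IsNonabelianParabolic ρ := by
  -- If wⁿ commuted with a, the relation wⁿa = bwⁿ would give a = b in the group.
  refine ⟨⟨proj k n (w k ^ n), proj k n a, fun hc => ?_⟩, ?_⟩
  · rw [← map_mul ρ, ← map_mul ρ] at hc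
    have h1 := h.injective hc
    have h2 := proj_relation (k := k) (n := n)
    rw [← map_zpow, h1] at h2
    exact proj_a_ne_proj_b hk N hN hn (mul_right_cancel h2)
  · by_contra hcon
    push Not at hcon
    have hcomm := congrArg ρ (longitude_comm (k := k) (n := n))
    rw [map_mul, map_mul] at hcomm
    obtain ⟨i, j, hij, hrel⟩ := exists_relation_of_discrete h.discrete
      (MonoidHom.mem_range.2 ⟨_, rfl⟩) (MonoidHom.mem_range.2 ⟨_, rfl⟩) hcomm hcon.1 hcon.2
    rw [← map_zpow ρ, ← map_zpow ρ, ← map_mul ρ, ← map_one ρ] at hrel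
    obtain ⟨rfl, rfl⟩ := zpow_mul_longitude_eq_one hk N hN hn (h.injective hrel)
    simp at hij

end Holonomy

end DoubleTwist

end

/-! ### Assembly of the extreme terms. -/

theorem proposition3p7 (k : ℕ) (hk : 1 ≤ k) (n : ℤ) (hn : n ≤ -1)
    (ρ : DoubleTwist.KnotGroup k n →* Matrix.SpecialLinearGroup (Fin 2) ℂ)
    (hρ : DoubleTwist.IsHolonomy ρ ∨ (k = 1 ∧ DoubleTwist.IsNonabelianParabolic ρ)) :
    (∀ m : ℕ, k = 2 * m →
      DoubleTwist.HasExtremeTerms (DoubleTwist.adjointTwistedAlexander ρ)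
        ((m : ℂ) * ((|n| : ℤ) : ℂ) * DoubleTwist.S ((m : ℤ) - 1) (DoubleTwist.yTrace ρ) ^ 2 *
          DoubleTwist.S (|n| - 1) (DoubleTwist.zTrace ρ) ^ 2) 0
        (-((m : ℂ) * ((|n| : ℤ) : ℂ) * DoubleTwist.S ((m : ℤ) - 1) (DoubleTwist.yTrace ρ) ^ 2 *
          DoubleTwist.S (|n| - 1) (DoubleTwist.zTrace ρ) ^ 2)) (-3)) ∧
    (∀ m : ℕ, k = 2 * m + 1 →
      DoubleTwist.HasExtremeTerms (DoubleTwist.adjointTwistedAlexander ρ)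
        (-(((m : ℂ) + 1) * DoubleTwist.S (m : ℤ) (DoubleTwist.yTrace ρ) ^ 2)) (-3)
        (((m : ℂ) + 1) * DoubleTwist.S (m : ℤ) (DoubleTwist.yTrace ρ) ^ 2) (6 * n)) := by
  open DoubleTwist in
  -- Writing |n| = N + 1 keeps the geometric sums in w⁻¹ nonempty, as the odd case needs for their
  -- leading terms.
  obtain ⟨N, hN⟩ : ∃ N : ℕ, n = -(N + 1 : ℕ) := ⟨(-n - 1).toNat, by omega⟩
  have hpar : IsNonabelianParabolic ρ := by
    rcases hρ with h | h
    · exact h.isNonabelianParabolic (by omega) (N + 1) (by omega) hN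
    · exact h.2
  obtain ⟨⟨g, h, hgh⟩, htr⟩ := hpar
  have hne : ρ (proj k n a) * ρ (proj k n b) ≠ ρ (proj k n b) * ρ (proj k n a) :=
    fun hc => hgh (commute_of_commute_a_b ρ hc g h)
  have hne' : ρ (proj k n a) ≠ ρ (proj k n b) := fun hc => hne (by rw [hc])
  have hab := trace_a_eq_trace_b ρ
  have htrb := htr
  rw [hab] at htrb
  have habs : |n| = ((N + 1 : ℕ) : ℤ) := by rw [hN, abs_neg, Nat.abs_cast]
  constructor
  · intro m hm
    obtain ⟨E, hE, hE0⟩ := lead_low_even ρ m (N + 1) hm hN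
    obtain ⟨F, hF, hF0⟩ := lead_high_even ρ m (N + 1) hm hN
    have hm0 : (m : ℂ) ≠ 0 := by
      rw [Nat.cast_ne_zero]; omega
    have hN0 : ((N + 1 : ℕ) : ℂ) ≠ 0 := by
      rw [Nat.cast_ne_zero]; omega
    have hc := mul_ne_zero (mul_ne_zero (mul_ne_zero hm0 hN0)
      (pow_ne_zero 2 (S_ne_zero_even_y ρ hm hne'))) (pow_ne_zero 2 (S_ne_zero_z ρ hN hne'))
    have key := hasExtremeTerms_of_lead ρ htrb hab hne hE hF (by rw [hE0]; exact neg_ne_zero.2 hc)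
      (by rw [hF0]; exact neg_ne_zero.2 hc)
    rw [hE0, hF0, neg_neg] at key
    rw [habs, Int.cast_natCast]
    exact key
  · intro m hm
    obtain ⟨E, hE, hE0⟩ := lead_low_odd ρ m N hm hN
    obtain ⟨F, hF, hF0⟩ := lead_high_odd ρ m N hm hN
    have hm0 : (m : ℂ) + 1 ≠ 0 := Nat.cast_add_one_ne_zero m
    have hc := mul_ne_zero hm0 (pow_ne_zero 2 (S_ne_zero_odd_y ρ hm hN htr hne'))
    have key := hasExtremeTerms_of_lead ρ htrb hab hne hE hF (by rw [hE0]; exact hc)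
      (by rw [hF0]; exact hc)
    rw [hE0, hF0] at key
    have e : (3 * -(2 * ((N + 1 : ℕ) : ℤ))) = 6 * n := by rw [hN]; ring
    rw [e] at key
    exact key
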